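/- Let $F$ be a field of arbitrary characteristic. A $\Gamma$-algebra over $F$ is a unital $\mathbb Z/2$-graded (not necessarily associative) $F$-algebra $\Gamma=\Gamma_0\oplus\Gamma_1$, with $1\in\Gamma_0$, such that $[\Gamma_0,\Gamma_1]=(\Gamma_0,\Gamma,\Gamma)=0$ (in particular $\Gamma_0$ is associative), $\Gamma_1^2\subseteq Z(\Gamma_0)$, and, for all $x,y,z\in\Gamma_1$, $xy+yx=0$, $x^2=0$ (which follows from the previous identity if $\operatorname{char}F\ne 2$) and $(xy)z+(yz)x+(zx)y=0$. A $\Gamma$-algebra is free on even generators $t_i$ and odd generators $v_j$ if every choice of even images for the $t_i$ and odd images for the $v_j$ in any $\Gamma$-algebra extends to a unique homomorphism of unital graded algebras. Let $m,n\ge 0$ and $A_n=F[x_1,\dots,x_n;y_1,\dots,y_n]$. Put $v_i=(x_i,y_i)\in A_n^2$, $V_i=Fv_i$, $V=\sum_i V_i$, and $\alpha_{ij}=x_iy_j-x_jy_i$. Let $S_n\subseteq A_n$ be the subalgebra generated by all $\alpha_{ij}$, let $S_n'$ be its augmentation ideal (the elements without constant term), and let $S_nV\subseteq A_n^2$ be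 the $S_n$-submodule generated by $v_1,\dots,v_n$. For $1\le j\le n$ let $B_{n,j}$ be the set of all products $\alpha_{i_1j_1}\cdots\alpha_{i_rj_r}$, $r\ge 0$, with $i_1\le\dots\le i_r$, $j\le j_1\le\dots\le j_r$ and $i_s<j_s$ for all $s$, and let $B_{n,j}V_j$ be the span of the $b v_j$, $b\in B_{n,j}$. Theorem. $S_nV=\bigoplus_{j=1}^n B_{n,j}V_j$, where the elements $bv_j$ $(b\in B_{n,j})$ form a basis of $B_{n,j}V_j$, and the free $\Gamma$-algebra $\Gamma[t_1,\dots,t_m;v_1,\dots,v_n]$ on even generators $t_1,\dots,t_m$ and odd generators $v_1,\dots,v_n$ is the graded space $$\Gamma_0=F\langle t_1,\dots,t_m\rangle\oplus\bigl(S_n'\otimes F[\bar t_1,\dots,\bar t_m]\bigr),\qquad \Gamma_1=F[\bar t_1,\dots,\bar t_m]\otimes\Bigl(\bigoplus_{j=1}^n B_{n,j}V_j\Bigr)$$ (with $t_i$ the generators of the free associative algebra $F\langle t_1,\dots,t_m\rangle$, and $v_j$ identified with $1\otimes v_j$) with the following multiplication: $F\langle t_1,\dots,t_m\rangle$ is a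 subalgebra; each $f\in F\langle t_1,\dots,t_m\rangle$ acts on the other two summands, from both sides, as multiplication of the tensor factor in $F[\bar t_1,\dots,\bar t_m]$ by the image $\bar f=f(\bar t_1,\dots,\bar t_m)$ of $f$ in that polynomial algebra; and those two summands multiply $F[\bar t_1,\dots,\bar t_m]$-bilinearly, by the multiplication of $S_n'$, by the action of $S_n'$ on $S_nV$ (from both sides), and by $(a,b)(c,d)=ad-bc$ on $S_nV$, so that $v_i\cdot v_j=\alpha_{ij}$. -/

import Mathlib

open scoped TensorProduct

universe u w

noncomputable section

namespace GammaAlg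

/-! ### Gamma-algebras and free Gamma-algebras -/

/-- A `Γ`-algebra over the field `F`: a unital, not necessarily associative, `ℤ/2`-graded algebra
`Γ = Γ₀ ⊕ Γ₁` with `Γ₀` associative, `[Γ₀, Γ₁] = (Γ₀, Γ, Γ) = 0`, `Γ₁² ⊆ Z(Γ₀)`, with alternating
multiplication on `Γ₁`, and `(xy)z + (yz)x + (zx)y = 0` on `Γ₁`.
The condition `odd_mul_self` follows from `odd_anticomm` if the characteristic is not two. -/
structure IsGammaAlgebra (F : Type u) [Field F] {G : Type w} [NonAssocRing G] [Module F G]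
    [IsScalarTower F G G] [SMulCommClass F G G] (Γ : ZMod 2 → Submodule F G) : Prop where
  isInternal : DirectSum.IsInternal Γ
  one_mem : (1 : G) ∈ Γ 0
  mul_mem : ∀ i j : ZMod 2, ∀ x ∈ Γ i, ∀ y ∈ Γ j, x * y ∈ Γ (i + j)
  -- the associator vanishes if its first argument is even; so `Γ₀` is associative
  assoc : ∀ a ∈ Γ 0, ∀ x y : G, (a * x) * y = a * (x * y)
  even_odd_comm : ∀ a ∈ Γ 0, ∀ x ∈ Γ 1, a * x = x * a
  odd_mul_odd_central : ∀ x ∈ Γ 1, ∀ y ∈ Γ 1, ∀ a ∈ Γ 0, (x * y) * a = a * (x * y)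
  odd_anticomm : ∀ x ∈ Γ 1, ∀ y ∈ Γ 1, x * y + y * x = 0
  odd_mul_self : ∀ x ∈ Γ 1, x * x = 0
  odd_cyclic : ∀ x ∈ Γ 1, ∀ y ∈ Γ 1, ∀ z ∈ Γ 1, (x * y) * z + (y * z) * x + (z * x) * y = 0

/-- The `Γ`-algebra `G` is free on the even generators `t i` and the odd generators `v j`:
every assignment of even elements to the `t i` and odd elements to the `v j` in a `Γ`-algebra
(in the universe `w`) extends to a unique homomorphism of unital graded algebras. -/
structure IsFreeGammaAlgebra (F : Type u) [Field F] {G : Type u} [NonAssocRing G] [Module F G]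
    [IsScalarTower F G G] [SMulCommClass F G G] (Γ : ZMod 2 → Submodule F G)
    {I J : Type} (t : I → G) (v : J → G) : Prop where
  isGammaAlgebra : IsGammaAlgebra F Γ
  even_gen : ∀ i, t i ∈ Γ 0
  odd_gen : ∀ j, v j ∈ Γ 1
  existsUnique_hom : ∀ (H : Type w) [NonAssocRing H] [Module F H]
    [IsScalarTower F H H] [SMulCommClass F H H] (Δ : ZMod 2 → Submodule F H),
    IsGammaAlgebra F Δ → ∀ (a : I → H) (b : J → H), (∀ i, a i ∈ Δ 0) → (∀ j, b j ∈ Δ 1) →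
    ∃! φ : G →ₙₐ[F] H, φ 1 = 1 ∧ (∀ k, ∀ x ∈ Γ k, φ x ∈ Δ k) ∧
      (∀ i, φ (t i) = a i) ∧ (∀ j, φ (v j) = b j)

/-! ### The algebra `S_n`, its augmentation ideal, and the module `S_n V` -/

/-- `A_n = F[x_1, …, x_n; y_1, …, y_n]`; `Sum.inl i` indexes `x_i` and `Sum.inr i` indexes `y_i`. -/
abbrev PolyXY (F : Type u) [Field F] (n : ℕ) : Type u := MvPolynomial (Fin n ⊕ Fin n) F

/-- The skew-symmetric product `(a, b)(c, d) = ad - bc` on `A_n²`. -/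
def wedge {F : Type u} [Field F] {n : ℕ} (p q : PolyXY F n × PolyXY F n) : PolyXY F n :=
  p.1 * q.2 - p.2 * q.1

/-- `v_i = (x_i, y_i) ∈ A_n²`. -/
def vec (F : Type u) [Field F] {n : ℕ} (i : Fin n) : PolyXY F n × PolyXY F n :=
  (MvPolynomial.X (Sum.inl i), MvPolynomial.X (Sum.inr i))

/-- `α_ij = x_i y_j - x_j y_i`. -/
def minor (F : Type u) [Field F] {n : ℕ} (i j : Fin n) : PolyXY F n :=
  MvPolynomial.X (Sum.inl i) * MvPolynomial.X (Sum.inr j)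
    - MvPolynomial.X (Sum.inl j) * MvPolynomial.X (Sum.inr i)

/-- `S_n`, the subalgebra of `A_n` generated by the `α_ij`. (As `α_ij = -α_ji` and `α_ii = 0`,
the `α_ij` with `i < j` suffice.) -/
def S (F : Type u) [Field F] (n : ℕ) : Subalgebra F (PolyXY F n) :=
  Algebra.adjoin F (Set.range fun p : Fin n × Fin n => minor F p.1 p.2)

/-- `α_ij` as an element of `S_n`. -/
def alpha (F : Type u) [Field F] {n : ℕ} (i j : Fin n) : S F n :=
  ⟨minor F i j, Algebra.subset_adjoin ⟨(i, j), rfl⟩⟩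

/-- `S_n'`, the augmentation ideal of `S_n`: the elements without constant term. -/
def SAug (F : Type u) [Field F] (n : ℕ) : Ideal (S F n) :=
  RingHom.ker ((MvPolynomial.constantCoeff (R := F) (σ := Fin n ⊕ Fin n)).comp
    (S F n).val.toRingHom)

theorem alpha_mem_SAug (F : Type u) [Field F] {n : ℕ} (i j : Fin n) : alpha F i j ∈ SAug F n := by
  simp [SAug, RingHom.mem_ker, alpha, minor]

/-- `α_ij` as an element of `S_n'`. -/
def alphaAug (F : Type u) [Field F] {n : ℕ} (i j : Fin n) : SAug F n :=
  ⟨alpha F i j, alpha_mem_SAug F i j⟩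

/-- `S_n V`, the `S_n`-submodule of `A_n²` generated by `v_1, …, v_n`. -/
def SV (F : Type u) [Field F] (n : ℕ) : Submodule (S F n) (PolyXY F n × PolyXY F n) :=
  Submodule.span (S F n) (Set.range (vec F (n := n)))

instance (F : Type u) [Field F] (n : ℕ) : Module (S F n) (SV F n) := Submodule.module _

instance (F : Type u) [Field F] (n : ℕ) : SMul (S F n) (SV F n) := Module.toDistribMulAction.toSMul

instance (F : Type u) [Field F] (n : ℕ) : DistribMulAction (S F n) (SV F n) :=
  Module.toDistribMulAction

instance (F : Type u) [Field F] (n : ℕ) : MulAction (S F n) (SV F n) :=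
  DistribMulAction.toMulAction

instance (F : Type u) [Field F] (n : ℕ) : DistribSMul (S F n) (SV F n) :=
  DistribMulAction.toDistribSMul

instance (F : Type u) [Field F] (n : ℕ) : Module F (SV F n) := Submodule.module' _

instance (F : Type u) [Field F] (n : ℕ) : SMul F (SV F n) := Module.toDistribMulAction.toSMul

instance (F : Type u) [Field F] (n : ℕ) : IsScalarTower F (S F n) (SV F n) :=
  Submodule.isScalarTower _

instance (F : Type u) [Field F] (n : ℕ) : SMulCommClass F (S F n) (SV F n) :=
  IsScalarTower.to_smulCommClass

instance (F : Type u) [Field F] (n : ℕ) : SMulCommClass (S F n) F (SV F n) :=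
  SMulCommClass.symm _ _ _

instance (F : Type u) [Field F] (n : ℕ) : Module (S F n) (SAug F n) := Submodule.module _

instance (F : Type u) [Field F] (n : ℕ) : SMul (S F n) (SAug F n) := Module.toDistribMulAction.toSMul

instance (F : Type u) [Field F] (n : ℕ) : DistribMulAction (S F n) (SAug F n) :=
  Module.toDistribMulAction

instance (F : Type u) [Field F] (n : ℕ) : MulAction (S F n) (SAug F n) :=
  DistribMulAction.toMulAction

instance (F : Type u) [Field F] (n : ℕ) : DistribSMul (S F n) (SAug F n) :=
  DistribMulAction.toDistribSMul

instance (F : Type u) [Field F] (n : ℕ) : Module F (SAug F n) := Submodule.module' _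

instance (F : Type u) [Field F] (n : ℕ) : SMul F (SAug F n) := Module.toDistribMulAction.toSMul

instance (F : Type u) [Field F] (n : ℕ) : IsScalarTower F (S F n) (SAug F n) :=
  Submodule.isScalarTower _

instance (F : Type u) [Field F] (n : ℕ) : SMulCommClass F (S F n) (SAug F n) :=
  IsScalarTower.to_smulCommClass

instance (F : Type u) [Field F] (n : ℕ) : SMulCommClass (S F n) F (SAug F n) :=
  SMulCommClass.symm _ _ _

/-- `v_i` as an element of `S_n V`. -/
def vecSV (F : Type u) [Field F] {n : ℕ} (i : Fin n) : SV F n :=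
  ⟨vec F i, Submodule.subset_span ⟨i, rfl⟩⟩

/-- The set `B_{n,m}` of all products `α_{i_1 j_1} ⋯ α_{i_r j_r}` (with `r ≥ 0`) such that
`i_1 ≤ ⋯ ≤ i_r`, `m ≤ j_1 ≤ ⋯ ≤ j_r` and `i_s < j_s` for all `s`. -/
def B (F : Type u) [Field F] {n : ℕ} (m : Fin n) : Set (S F n) :=
  {b | ∃ (r : ℕ) (i j : Fin r → Fin n), Monotone i ∧ Monotone j ∧ (∀ s, i s < j s) ∧
    (∀ s, m ≤ j s) ∧ b = ∏ s, alpha F (i s) (j s)}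

/-- `B_{n,j} V_j`, the subspace of `S_n V` spanned by all `b v_j` with `b ∈ B_{n,j}`. -/
def BV (F : Type u) [Field F] {n : ℕ} (j : Fin n) : Submodule F (SV F n) :=
  Submodule.span F ((fun b : S F n => b • vecSV F j) '' B F j)

theorem wedge_vec {F : Type u} [Field F] {n : ℕ} (i j : Fin n) :
    wedge (vec F i) (vec F j) = minor F i j := by
  simp only [wedge, vec, minor]; ring

theorem wedge_mem {F : Type u} [Field F] {n : ℕ} {p q : PolyXY F n × PolyXY F n}
    (hp : p ∈ SV F n) (hq : q ∈ SV F n) : wedge p q ∈ S F n := by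
  induction hp using Submodule.span_induction with
  | mem p hp =>
    obtain ⟨i, rfl⟩ := hp
    induction hq using Submodule.span_induction with
    | mem q hq =>
      obtain ⟨j, rfl⟩ := hq
      rw [wedge_vec]; exact (alpha F i j).2
    | zero => simp [wedge]
    | add a b _ _ ha hb =>
      have : wedge (vec F i) (a + b) = wedge (vec F i) a + wedge (vec F i) b := by
        simp only [wedge, Prod.fst_add, Prod.snd_add]; ring
      rw [this]; exact add_mem ha hb
    | smul s a _ ha =>
      have : wedge (vec F i) (s • a) = (s : PolyXY F n) * wedge (vec F i) a := by
        simp only [wedge, Prod.smul_fst, Prod.smul_snd, Subalgebra.smul_def, smul_eq_mul]; ring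
      rw [this]; exact mul_mem s.2 ha
  | zero => simp [wedge]
  | add a b _ _ ha hb =>
    have : wedge (a + b) q = wedge a q + wedge b q := by
      simp only [wedge, Prod.fst_add, Prod.snd_add]; ring
    rw [this]; exact add_mem ha hb
  | smul s a _ ha =>
    have : wedge (s • a) q = (s : PolyXY F n) * wedge a q := by
      simp only [wedge, Prod.smul_fst, Prod.smul_snd, Subalgebra.smul_def, smul_eq_mul]; ring
    rw [this]; exact mul_mem s.2 ha

theorem constantCoeff_of_mem {F : Type u} [Field F] {n : ℕ} {p : PolyXY F n × PolyXY F n}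
    (hp : p ∈ SV F n) :
    MvPolynomial.constantCoeff p.1 = 0 ∧ MvPolynomial.constantCoeff p.2 = 0 := by
  induction hp using Submodule.span_induction with
  | mem p hp => obtain ⟨i, rfl⟩ := hp; simp [vec]
  | zero => simp
  | add a b _ _ ha hb => simp [ha.1, ha.2, hb.1, hb.2]
  | smul s a _ ha => simp [Subalgebra.smul_def, ha.1, ha.2]

/-- The product `S_n V × S_n V → S_n'`, `(a, b)(c, d) = ad - bc`. -/
def oddForm (F : Type u) [Field F] (n : ℕ) : SV F n →ₗ[F] SV F n →ₗ[F] SAug F n :=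
  LinearMap.mk₂ F
    (fun p q => ⟨⟨wedge p.1 q.1, wedge_mem p.2 q.2⟩, by
      simp [SAug, RingHom.mem_ker, wedge, constantCoeff_of_mem p.2]⟩)
    (fun p p' q => by
      ext1; ext1; simp [wedge]; ring)
    (fun c p q => by
      ext1; ext1; simp [wedge, smul_sub])
    (fun p q q' => by
      ext1; ext1; simp [wedge]; ring)
    (fun c p q => by
      ext1; ext1; simp [wedge, smul_sub])

/-- The product `S_n' × S_n' → S_n'`. -/
def augMul (F : Type u) [Field F] (n : ℕ) : SAug F n →ₗ[F] SAug F n →ₗ[F] SAug F n :=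
  LinearMap.mk₂ F (fun s s' => (s : S F n) • s')
    (fun s s' q => by simp [add_smul])
    (fun c s q => by simp)
    (fun s q q' => by simp)
    (fun c s q => by rw [smul_comm])

/-- The action `S_n' × S_n V → S_n V`. -/
def augAct (F : Type u) [Field F] (n : ℕ) : SAug F n →ₗ[F] SV F n →ₗ[F] SV F n :=
  LinearMap.mk₂ F (fun s p => (s : S F n) • p)
    (fun s s' q => by simp [add_smul])
    (fun c s q => by simp)
    (fun s q q' => by simp)
    (fun c s q => by rw [smul_comm])

theorem coe_oddForm {F : Type u} [Field F] {n : ℕ} (p q : SV F n) :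
    ((oddForm F n p q : S F n) : PolyXY F n) = wedge p.1 q.1 := rfl

theorem coe_augMul {F : Type u} [Field F] {n : ℕ} (s s' : SAug F n) :
    ((augMul F n s s' : S F n) : PolyXY F n) = ((s : S F n) : PolyXY F n) * (s' : S F n) := rfl

theorem coe_augAct {F : Type u} [Field F] {n : ℕ} (s : SAug F n) (p : SV F n) :
    (augAct F n s p : PolyXY F n × PolyXY F n) =
      (((s : S F n) : PolyXY F n) * p.1.1, ((s : S F n) : PolyXY F n) * p.1.2) := rfl

/-! ### The graded algebra `(F⟨t⟩ ⊕ F[t̄] ⊗ S_n') ⊕ F[t̄] ⊗ S_n V` -/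

/-- The free associative algebra `F⟨t_1, …, t_m⟩`. -/
abbrev FreeT (F : Type u) [Field F] (m : ℕ) : Type u := FreeAlgebra F (Fin m)

/-- The polynomial algebra `F[t̄_1, …, t̄_m]`. -/
abbrev PolyT (F : Type u) [Field F] (m : ℕ) : Type u := MvPolynomial (Fin m) F

/-- The natural epimorphism `f ↦ f̄` from `F⟨t_1, …, t_m⟩` to `F[t̄_1, …, t̄_m]`. -/
def bar (F : Type u) [Field F] (m : ℕ) : FreeT F m →ₐ[F] PolyT F m :=
  FreeAlgebra.lift F MvPolynomial.X

/-- The underlying space `F⟨t⟩ ⊕ (F[t̄] ⊗ S_n') ⊕ (F[t̄] ⊗ S_n V)`. -/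
@[ext]
structure Model (F : Type u) [Field F] (m n : ℕ) : Type u where
  free : FreeT F m
  aug : PolyT F m ⊗[F] SAug F n
  odd : PolyT F m ⊗[F] SV F n

namespace Model

instance (F : Type u) [Field F] (m n : ℕ) :
    IsScalarTower F (PolyT F m) (PolyT F m ⊗[F] SAug F n) := TensorProduct.isScalarTower_left

instance (F : Type u) [Field F] (m n : ℕ) :
    IsScalarTower F (PolyT F m) (PolyT F m ⊗[F] SV F n) := TensorProduct.isScalarTower_left

instance (F : Type u) [Field F] (m n : ℕ) :
    SMulCommClass (PolyT F m) F (PolyT F m ⊗[F] SAug F n) := TensorProduct.smulCommClass_left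

instance (F : Type u) [Field F] (m n : ℕ) :
    SMulCommClass (PolyT F m) F (PolyT F m ⊗[F] SV F n) := TensorProduct.smulCommClass_left

/-- The triples as a product of vector spaces. -/
def equivProd (F : Type u) [Field F] (m n : ℕ) :
    Model F m n ≃ FreeT F m × (PolyT F m ⊗[F] SAug F n) × (PolyT F m ⊗[F] SV F n) where
  toFun x := (x.free, x.aug, x.odd)
  invFun p := ⟨p.1, p.2.1, p.2.2⟩
  left_inv _ := rfl
  right_inv _ := rfl

instance (F : Type u) [Field F] (m n : ℕ) : AddCommGroup (Model F m n) :=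
  (equivProd F m n).addCommGroup

instance (F : Type u) [Field F] (m n : ℕ) : Module F (Model F m n) :=
  (equivProd F m n).module F

/-- The inclusion of `F⟨t⟩`. -/
def ofFree (F : Type u) [Field F] (m n : ℕ) : FreeT F m →ₗ[F] Model F m n :=
  ((equivProd F m n).linearEquiv F).symm.toLinearMap ∘ₗ LinearMap.inl F _ _

/-- The inclusion of `F[t̄] ⊗ S_n'`. -/
def ofAug (F : Type u) [Field F] (m n : ℕ) : PolyT F m ⊗[F] SAug F n →ₗ[F] Model F m n :=
  ((equivProd F m n).linearEquiv F).symm.toLinearMap ∘ₗ LinearMap.inr F _ _ ∘ₗ LinearMap.inl F _ _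

/-- The inclusion of `F[t̄] ⊗ S_n V`. -/
def ofOdd (F : Type u) [Field F] (m n : ℕ) : PolyT F m ⊗[F] SV F n →ₗ[F] Model F m n :=
  ((equivProd F m n).linearEquiv F).symm.toLinearMap ∘ₗ LinearMap.inr F _ _ ∘ₗ LinearMap.inr F _ _

/-- The grading: `Γ₀ = F⟨t⟩ ⊕ (F[t̄] ⊗ S_n')` and `Γ₁ = F[t̄] ⊗ S_n V`. -/
def grading (F : Type u) [Field F] (m n : ℕ) (k : ZMod 2) : Submodule F (Model F m n) :=
  if k = 0 then LinearMap.range (ofFree F m n) ⊔ LinearMap.range (ofAug F m n)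
  else LinearMap.range (ofOdd F m n)

/-- The multiplication: `F⟨t⟩` multiplies as the free algebra and acts on the other two summands
from both sides through `f ↦ f̄`; the products of those summands are the `F[t̄]`-bilinear
extensions of the products of `S_n' ⊕ S_n V`. -/
instance (F : Type u) [Field F] (m n : ℕ) : Mul (Model F m n) where
  mul x y :=
    ⟨x.free * y.free,
     bar F m x.free • y.aug + bar F m y.free • x.aug
      + TensorProduct.map₂ (LinearMap.mul F (PolyT F m)) (augMul F n) x.aug y.aug
      + TensorProduct.map₂ (LinearMap.mul F (PolyT F m)) (oddForm F n) x.odd y.odd,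
     bar F m x.free • y.odd + bar F m y.free • x.odd
      + TensorProduct.map₂ (LinearMap.mul F (PolyT F m)) (augAct F n) x.aug y.odd
      + TensorProduct.map₂ (LinearMap.mul F (PolyT F m)) (augAct F n) y.aug x.odd⟩

instance (F : Type u) [Field F] (m n : ℕ) : One (Model F m n) where
  one := ⟨1, 0, 0⟩

section
variable {F : Type u} [Field F] {m n : ℕ}

theorem ofFree_apply (f : FreeT F m) : ofFree F m n f = ⟨f, 0, 0⟩ := rfl
theorem ofAug_apply (s : PolyT F m ⊗[F] SAug F n) : ofAug F m n s = ⟨0, s, 0⟩ := rfl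
theorem ofOdd_apply (w : PolyT F m ⊗[F] SV F n) : ofOdd F m n w = ⟨0, 0, w⟩ := rfl

theorem mul_free (x y : Model F m n) : (x * y).free = x.free * y.free := rfl
theorem mul_aug (x y : Model F m n) : (x * y).aug =
    bar F m x.free • y.aug + bar F m y.free • x.aug
      + TensorProduct.map₂ (LinearMap.mul F (PolyT F m)) (augMul F n) x.aug y.aug
      + TensorProduct.map₂ (LinearMap.mul F (PolyT F m)) (oddForm F n) x.odd y.odd := rfl
theorem mul_odd (x y : Model F m n) : (x * y).odd =
    bar F m x.free • y.odd + bar F m y.free • x.odd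
      + TensorProduct.map₂ (LinearMap.mul F (PolyT F m)) (augAct F n) x.aug y.odd
      + TensorProduct.map₂ (LinearMap.mul F (PolyT F m)) (augAct F n) y.aug x.odd := rfl
theorem one_free : (1 : Model F m n).free = 1 := rfl
theorem one_aug : (1 : Model F m n).aug = 0 := rfl
theorem one_odd : (1 : Model F m n).odd = 0 := rfl
theorem zero_free : (0 : Model F m n).free = 0 := rfl
theorem zero_aug : (0 : Model F m n).aug = 0 := rfl
theorem zero_odd : (0 : Model F m n).odd = 0 := rfl
theorem add_free (x y : Model F m n) : (x + y).free = x.free + y.free := rfl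
theorem add_aug (x y : Model F m n) : (x + y).aug = x.aug + y.aug := rfl
theorem add_odd (x y : Model F m n) : (x + y).odd = x.odd + y.odd := rfl
theorem smul_free (c : F) (x : Model F m n) : (c • x).free = c • x.free := rfl
theorem smul_aug (c : F) (x : Model F m n) : (c • x).aug = c • x.aug := rfl
theorem smul_odd (c : F) (x : Model F m n) : (c • x).odd = c • x.odd := rfl

end

instance (F : Type u) [Field F] (m n : ℕ) : NonAssocRing (Model F m n) :=
  { (inferInstance : AddCommGroup (Model F m n)), (inferInstance : Mul (Model F m n)),
    (inferInstance : One (Model F m n)) with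
    left_distrib := fun x y z => by
      ext1 <;> simp only [mul_free, mul_aug, mul_odd, add_free, add_aug, add_odd, mul_add, map_add,
        add_smul, smul_add, LinearMap.add_apply] <;> abel
    right_distrib := fun x y z => by
      ext1 <;> simp only [mul_free, mul_aug, mul_odd, add_free, add_aug, add_odd, add_mul, map_add,
        add_smul, smul_add, LinearMap.add_apply] <;> abel
    zero_mul := fun x => by
      ext1 <;> simp [mul_free, mul_aug, mul_odd, zero_free, zero_aug, zero_odd]
    mul_zero := fun x => by
      ext1 <;> simp [mul_free, mul_aug, mul_odd, zero_free, zero_aug, zero_odd]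
    one_mul := fun x => by
      ext1 <;> simp [mul_free, mul_aug, mul_odd, one_free, one_aug, one_odd]
    mul_one := fun x => by
      ext1 <;> simp [mul_free, mul_aug, mul_odd, one_free, one_aug, one_odd] }

instance (F : Type u) [Field F] (m n : ℕ) : IsScalarTower F (Model F m n) (Model F m n) where
  smul_assoc c x y := by
    simp only [smul_eq_mul]
    ext1 <;> simp only [mul_free, mul_aug, mul_odd, smul_free, smul_aug, smul_odd, map_smul,
      LinearMap.smul_apply, smul_add, smul_mul_assoc, smul_assoc, smul_comm _ c]

instance (F : Type u) [Field F] (m n : ℕ) : SMulCommClass F (Model F m n) (Model F m n) where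
  smul_comm c x y := by
    simp only [smul_eq_mul]
    ext1 <;> simp only [mul_free, mul_aug, mul_odd, smul_free, smul_aug, smul_odd, map_smul,
      LinearMap.smul_apply, smul_add, mul_smul_comm, smul_assoc, smul_comm _ c]

/-- The even generator `t_i`. -/
def genT (F : Type u) [Field F] {m : ℕ} (n : ℕ) (i : Fin m) : Model F m n :=
  ofFree F m n (FreeAlgebra.ι F i)

/-- The odd generator `v_j`, that is, `1 ⊗ v_j`. -/
def genV (F : Type u) [Field F] (m : ℕ) {n : ℕ} (j : Fin n) : Model F m n :=
  ofOdd F m n (1 ⊗ₜ vecSV F j)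

end Model

end GammaAlg

end

/-! That the model is a `Γ`-algebra is a computation with vectors in the plane: `wedge` is
alternating, and any three plane vectors satisfy (p∧q)r + (q∧r)p + (r∧p)q = 0. The content is that
the axioms force every relation of the model, so that a choice of images of the generators extends
to a homomorphism. Two facts carry this.

Firstly, `S_n` and `S_n V` have presentations. For commuting elements `c i j` with `c i i = 0`,
antisymmetry and the Plücker relations, straightening rewrites every product as a combination of
standard products: two nested pairs i < k < l < j are replaced by crossing and disjoint ones. The
cyclic relation similarly trades α_ab v_j with a < b < j for multiples of v_a and v_b, which leaves
only the b v_j with b in `B_{n,j}`. In `A_n` the minor α_ij with i < j has leading monomial x_i y_j,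
and a standard product is recovered from its leading monomial, so the spanning families are linearly
independent there. This gives the bases, and, through a graph argument, maps from `S_n` and `S_n V`
to anything that obeys the relations (`exists_algHom_alpha`, `exists_linearMap_vecSV`).

Secondly, in a `Γ`-algebra commutators of even elements annihilate Γ₁, because a(bx) = (bx)a = b(xa)
= b(ax), and hence also Γ₁². The even generators therefore act on Γ₁ and Γ₁² through a polynomial
algebra (`exists_tensor_lift`). Multiplying the cyclic identity by a fourth odd element gives the
Plücker relation for products of odd elements (`odd_plucker`), so the presentations apply
(`exists_hom_S_SV`). The pieces are glued in `exists_hom_model`; uniqueness is `hom_ext`, which says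
that the generators generate. -/

namespace GammaAlg

/-! ### Standard products and straightening -/

/-- A list of pairs is standard if it is a chain of increasing pairs in the product order. -/
def IsStandard {n : ℕ} (l : List (Fin n × Fin n)) : Prop :=
  l.Pairwise (· ≤ ·) ∧ ∀ p ∈ l, p.1 < p.2

/-- The lexicographic order is a linear extension of the product order, so on a chain the two agree
and a lexicographic sort is sorted for the product order. -/
theorem exists_pairwise_le_of_chain {n : ℕ} (L : Multiset (Fin n × Fin n))
    (h : ∀ p ∈ L, ∀ q ∈ L, p ≤ q ∨ q ≤ p) :
    ∃ l : List (Fin n × Fin n), (l : Multiset (Fin n × Fin n)) = L ∧ l.Pairwise (· ≤ ·) := by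
  let L' : Multiset (Fin n ×ₗ Fin n) := L.map toLex
  refine ⟨(L'.sort (· ≤ ·)).map ofLex, ?_, ?_⟩
  · rw [← Multiset.map_coe, Multiset.sort_eq, Multiset.map_map]
    exact Multiset.map_id L
  · rw [List.pairwise_map]
    refine (Multiset.pairwise_sort L' (· ≤ ·)).imp_of_mem fun {a b} ha hb hab => ?_
    have ha' : ofLex a ∈ L := by
      rw [Multiset.mem_sort] at ha
      obtain ⟨p, hp, rfl⟩ := Multiset.mem_map.1 ha
      exact hp
    have hb' : ofLex b ∈ L := by
      rw [Multiset.mem_sort] at hb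
      obtain ⟨p, hp, rfl⟩ := Multiset.mem_map.1 hb
      exact hp
    rcases h _ ha' _ hb' with h | h
    · exact h
    · have h2 : b ≤ a := Prod.Lex.toLex_mono h
      rw [le_antisymm hab h2]

/-- The sum of the squared lengths of the intervals `[i, j]` in a multiset of pairs. -/
def sqLength {n : ℕ} (L : Multiset (Fin n × Fin n)) : ℕ :=
  (L.map fun p => ((p.2 : ℕ) - p.1) ^ 2).sum

/-- A product that is not standard contains two strictly nested pairs. Both terms of the relation
for such pairs have smaller `sqLength`, so the rewriting terminates. -/
theorem prod_mem_span_standard {F : Type*} [Field F] {n : ℕ} {R : Type*} [CommRing R] [Algebra F R]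
    (c : Fin n × Fin n → R)
    (hc : ∀ i k l j, i < k → k < l → l < j →
      c (i, j) * c (k, l) = c (i, l) * c (k, j) - c (i, k) * c (l, j))
    (L : Multiset (Fin n × Fin n)) (hL : ∀ p ∈ L, p.1 < p.2) :
    (L.map c).prod ∈ Submodule.span F {x | ∃ l, IsStandard l ∧ x = (l.map c).prod} := by
  induction hN : sqLength L using Nat.strong_induction_on generalizing L with
  | _ N ih =>
  subst hN
  by_cases h : ∀ p ∈ L, ∀ q ∈ L, p ≤ q ∨ q ≤ p
  · obtain ⟨l, rfl, hl⟩ := exists_pairwise_le_of_chain L h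
    exact Submodule.subset_span ⟨l, ⟨hl, fun p hp => hL p (by simpa using hp)⟩, by simp⟩
  push Not at h
  -- Incomparable in the product order means strictly nested: [k, l] lies inside [i, j].
  have key : ∃ i k l j : Fin n, i < k ∧ l < j ∧ (i, j) ∈ L ∧ (k, l) ∈ L := by
    obtain ⟨⟨a, b⟩, hp, ⟨a', b'⟩, hq, h1, h2⟩ := h
    simp only [Prod.mk_le_mk, not_and_or, not_le] at h1 h2
    rcases h1 with h1 | h1 <;> rcases h2 with h2 | h2
    · exact absurd h1 h2.asymm
    · exact ⟨a', a, b, b', h1, h2, hq, hp⟩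
    · exact ⟨a, a', b', b, h2, h1, hp, hq⟩
    · exact absurd h1 h2.asymm
  obtain ⟨i, k, l, j, hik, hlj, hp, hq⟩ := key
  have hkl : k < l := hL _ hq
  obtain ⟨L₁, rfl⟩ := Multiset.exists_cons_of_mem hp
  have hq' : (k, l) ∈ L₁ := by
    rcases Multiset.mem_cons.1 hq with h | h
    · exact absurd (Prod.mk.inj h).1 hik.ne'
    · exact h
  obtain ⟨L₂, rfl⟩ := Multiset.exists_cons_of_mem hq'
  have e : (((i, j) ::ₘ (k, l) ::ₘ L₂).map c).prod =
      (((i, l) ::ₘ (k, j) ::ₘ L₂).map c).prod - (((i, k) ::ₘ (l, j) ::ₘ L₂).map c).prod := by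
    simp only [Multiset.map_cons, Multiset.prod_cons, ← mul_assoc, hc i k l j hik hkl hlj]
    ring
  rw [e]
  have hik' : (i : ℕ) < k := hik
  have hkl' : (k : ℕ) < l := hkl
  have hlj' : (l : ℕ) < j := hlj
  have hL2 : ∀ p ∈ L₂, p.1 < p.2 := fun p hp => hL p (by simp [hp])
  refine Submodule.sub_mem _ (ih _ ?_ _ ?_ rfl) (ih _ ?_ _ ?_ rfl)
  · simp only [sqLength, Multiset.map_cons, Multiset.sum_cons]
    -- The gaps k - i, l - k, j - l are p + 1, q + 1, r + 1. Passing from nested to crossing pairs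
    -- lowers the sum of squares by 2(p + 1)(r + 1).
    obtain ⟨p, hp⟩ := Nat.exists_eq_add_of_lt hik'
    obtain ⟨q, hq⟩ := Nat.exists_eq_add_of_lt hkl'
    obtain ⟨r, hr⟩ := Nat.exists_eq_add_of_lt hlj'
    have e1 : (l : ℕ) - i = p + q + 2 := by omega
    have e2 : (j : ℕ) - k = q + r + 2 := by omega
    have e3 : (j : ℕ) - i = p + q + r + 3 := by omega
    have e4 : (l : ℕ) - k = q + 1 := by omega
    rw [e1, e2, e3, e4]
    nlinarith [Nat.zero_le (p * r)]
  · intro x hx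
    simp only [Multiset.mem_cons] at hx
    rcases hx with rfl | rfl | hx
    · exact hik.trans hkl
    · exact hkl.trans hlj
    · exact hL2 x hx
  · simp only [sqLength, Multiset.map_cons, Multiset.sum_cons]
    obtain ⟨p, hp⟩ := Nat.exists_eq_add_of_lt hik'
    obtain ⟨q, hq⟩ := Nat.exists_eq_add_of_lt hkl'
    obtain ⟨r, hr⟩ := Nat.exists_eq_add_of_lt hlj'
    have e1 : (k : ℕ) - i = p + 1 := by omega
    have e2 : (j : ℕ) - l = r + 1 := by omega
    have e3 : (j : ℕ) - i = p + q + r + 3 := by omega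
    have e4 : (l : ℕ) - k = q + 1 := by omega
    rw [e1, e2, e3, e4]
    nlinarith [Nat.zero_le (p * r), Nat.zero_le (p * q), Nat.zero_le (q * r)]
  · intro x hx
    simp only [Multiset.mem_cons] at hx
    rcases hx with rfl | rfl | hx
    · exact hik
    · exact hlj
    · exact hL2 x hx

/-- Straightening: in a commutative algebra, elements `c i j` that satisfy the relations of
`2 × 2` minors generate a subalgebra spanned by the standard products. -/
theorem adjoin_le_span_standard {F : Type*} [Field F] {n : ℕ} {R : Type*} [CommRing R]
    [Algebra F R] (c : Fin n → Fin n → R) (hself : ∀ i, c i i = 0) (hanti : ∀ i j, c i j = -c j i)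
    (hc : ∀ i j k l, c i j * c k l - c i k * c j l + c i l * c j k = 0) :
    Subalgebra.toSubmodule (Algebra.adjoin F (Set.range fun p : Fin n × Fin n => c p.1 p.2)) ≤
      Submodule.span F {x | ∃ l : List (Fin n × Fin n), IsStandard l ∧
        x = (l.map fun p => c p.1 p.2).prod} := by
  have h1 : Algebra.adjoin F (Set.range fun p : Fin n × Fin n => c p.1 p.2) ≤
      Algebra.adjoin F ((fun p : Fin n × Fin n => c p.1 p.2) '' {p | p.1 < p.2}) := by
    rw [Algebra.adjoin_le_iff]
    rintro _ ⟨⟨i, j⟩, rfl⟩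
    rcases lt_trichotomy i j with h | h | h
    · exact Algebra.subset_adjoin ⟨(i, j), h, rfl⟩
    · subst h
      simp [hself]
    · have := neg_mem (Algebra.subset_adjoin (R := F)
        (s := ((fun p : Fin n × Fin n => c p.1 p.2) '' {p | p.1 < p.2})) ⟨(j, i), h, rfl⟩)
      simp only
      rw [hanti]
      exact this
  refine le_trans (Subalgebra.toSubmodule.monotone h1) ?_
  rw [Algebra.adjoin_eq_span, Submodule.span_le]
  intro x hx
  have hx' : ∃ L : Multiset (Fin n × Fin n), (∀ p ∈ L, p.1 < p.2) ∧
      (L.map fun p => c p.1 p.2).prod = x := by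
    induction hx using Submonoid.closure_induction with
    | mem x hx =>
      obtain ⟨p, hp, rfl⟩ := hx
      exact ⟨{p}, by simpa using hp, by simp⟩
    | one => exact ⟨0, by simp, by simp⟩
    | mul x y _ _ hx hy =>
      obtain ⟨L, hL, rfl⟩ := hx
      obtain ⟨L', hL', rfl⟩ := hy
      refine ⟨L + L', fun p hp => ?_, by simp⟩
      rcases Multiset.mem_add.1 hp with h | h
      exacts [hL p h, hL' p h]
  obtain ⟨L, hL, rfl⟩ := hx'
  refine prod_mem_span_standard (fun p => c p.1 p.2) (fun i k l j _ _ _ => ?_) L hL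
  have := hc i k l j
  have e := hanti l j
  simp only
  linear_combination this

/-! ### Leading monomials -/

/-- In a vanishing combination the largest leading monomial occurs in only one term with nonzero
coefficient, so it cannot cancel. -/
theorem linearIndependent_of_injective_degree {F σ ι : Type*} [Field F] (m : MonomialOrder σ)
    (f : ι → MvPolynomial σ F) (h0 : ∀ i, f i ≠ 0)
    (hinj : Function.Injective fun i => m.degree (f i)) : LinearIndependent F f := by
  classical
  rw [linearIndependent_iff']
  intro s g hg
  by_contra! hne
  obtain ⟨i₀, hi₀, hgi₀⟩ := hne
  obtain ⟨i, hi, hmax⟩ := Finset.exists_max_image (s.filter fun i => g i ≠ 0)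
    (fun i => m.toSyn (m.degree (f i))) ⟨i₀, by simp [hi₀, hgi₀]⟩
  rw [Finset.mem_filter] at hi
  have hcoeff := congrArg (MvPolynomial.coeff (m.degree (f i))) hg
  rw [MvPolynomial.coeff_sum, Finset.sum_eq_single i] at hcoeff
  · rw [MvPolynomial.coeff_smul, MvPolynomial.coeff_zero, smul_eq_mul, mul_eq_zero] at hcoeff
    rcases hcoeff with h | h
    · exact hi.2 h
    · exact h0 i ((m.coeff_degree_eq_zero_iff).1 h)
  · intro j hj hji
    by_cases hgj : g j = 0
    · simp [hgj]
    rw [MvPolynomial.coeff_smul, m.coeff_eq_zero_of_lt, smul_zero]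
    refine lt_of_le_of_ne (hmax j (by simp [hj, hgj])) fun h => hji (hinj (m.toSyn.injective h))
  · exact fun h => absurd hi.1 h

/-- The order `x_1 < ⋯ < x_n < y_1 < ⋯ < y_n` of the variables. -/
abbrev xyLinearOrder (n : ℕ) : LinearOrder (Fin n ⊕ Fin n) :=
  LinearOrder.lift' (toLex : Fin n ⊕ Fin n → Fin n ⊕ₗ Fin n) toLex.injective

/-- The lexicographic monomial order, in which `x_1` is the largest variable. -/
noncomputable def xyOrder (n : ℕ) : MonomialOrder (Fin n ⊕ Fin n) :=
  @MonomialOrder.lex _ (xyLinearOrder n)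
    (@Finite.to_wellFoundedGT _ _ (xyLinearOrder n).toPreorder)

/-- The exponent of `x_i y_j`. -/
noncomputable def xyExp {n : ℕ} (p : Fin n × Fin n) : (Fin n ⊕ Fin n) →₀ ℕ :=
  Finsupp.single (Sum.inl p.1) 1 + Finsupp.single (Sum.inr p.2) 1

/-- Of the two monomials of a minor, x_i y_j wins: x_i is the first variable at which the exponents
differ. -/
theorem xyExp_lt {n : ℕ} {i j : Fin n} (h : i < j) :
    (xyOrder n).toSyn (xyExp (j, i)) < (xyOrder n).toSyn (xyExp (i, j)) := by
  refine (@MonomialOrder.lex_lt_iff _ (xyLinearOrder n)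
    (@Finite.to_wellFoundedGT _ _ (xyLinearOrder n).toPreorder) _ _).2 ?_
  refine (@Finsupp.Lex.lt_iff _ _ _ (xyLinearOrder n).toLT _ _ _).2 ?_
  refine ⟨Sum.inl i, ?_, ?_⟩
  · rintro (a | a) ha
    · have ha' : a < i := Sum.Lex.inl_lt_inl_iff.1 ha
      simp [xyExp, ha'.ne', (ha'.trans h).ne']
    · exact absurd ha Sum.Lex.not_inr_lt_inl
  · simp [xyExp, h.ne']

theorem minor_eq_monomial (F : Type u) [Field F] {n : ℕ} (i j : Fin n) :
    minor F i j = MvPolynomial.monomial (xyExp (i, j)) 1 - MvPolynomial.monomial (xyExp (j, i)) 1 := by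
  simp [minor, xyExp, MvPolynomial.X, MvPolynomial.monomial_mul]

theorem monic_minor (F : Type u) [Field F] {n : ℕ} {i j : Fin n} (h : i < j) :
    (xyOrder n).Monic (minor F i j) ∧ (xyOrder n).degree (minor F i j) = xyExp (i, j) := by
  classical
  have hlt : (xyOrder n).toSyn ((xyOrder n).degree
      (-MvPolynomial.monomial (xyExp (j, i)) (1 : F))) <
      (xyOrder n).toSyn ((xyOrder n).degree (MvPolynomial.monomial (xyExp (i, j)) (1 : F))) := by
    rw [MonomialOrder.degree_neg, MonomialOrder.degree_monomial, MonomialOrder.degree_monomial]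
    simpa using xyExp_lt h
  rw [minor_eq_monomial, sub_eq_add_neg]
  refine ⟨MonomialOrder.Monic.add_of_lt MonomialOrder.monic_monomial_one hlt, ?_⟩
  rw [MonomialOrder.degree_add_of_lt hlt, MonomialOrder.degree_monomial]
  simp

theorem monic_prod_minor (F : Type u) [Field F] {n : ℕ} (l : List (Fin n × Fin n))
    (hl : ∀ p ∈ l, p.1 < p.2) :
    (xyOrder n).Monic (l.map fun p => minor F p.1 p.2).prod ∧
      (xyOrder n).degree (l.map fun p => minor F p.1 p.2).prod = (l.map xyExp).sum := by
  induction l with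
  | nil => simp [MonomialOrder.monic_one]
  | cons p l ih =>
    obtain ⟨h1, h2⟩ := ih fun q hq => hl q (by simp [hq])
    obtain ⟨h3, h4⟩ := monic_minor F (hl p (by simp))
    simp only [List.map_cons, List.prod_cons, List.sum_cons]
    refine ⟨h3.mul h1, ?_⟩
    rw [MonomialOrder.degree_mul h3.ne_zero h1.ne_zero, h2, h4]

/-! ### Recovering a standard product from its leading monomial -/

theorem sum_xyExp_inl {n : ℕ} (l : List (Fin n × Fin n)) (i : Fin n) :
    (l.map xyExp).sum (Sum.inl i) = (l.map Prod.fst).count i := by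
  induction l with
  | nil => simp
  | cons p l ih =>
    simp [ih, xyExp, List.count_cons, Finsupp.single_apply, add_comm]

theorem sum_xyExp_inr {n : ℕ} (l : List (Fin n × Fin n)) (i : Fin n) :
    (l.map xyExp).sum (Sum.inr i) = (l.map Prod.snd).count i := by
  induction l with
  | nil => simp
  | cons p l ih =>
    simp [ih, xyExp, List.count_cons, Finsupp.single_apply, add_comm]

/-- Both columns of a standard list are sorted, so each is determined by its multiset of entries,
and together they determine the list. -/
theorem IsStandard.eq_of_perm {n : ℕ} {l l' : List (Fin n × Fin n)} (hl : IsStandard l)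
    (hl' : IsStandard l') (h1 : (l.map Prod.fst).Perm (l'.map Prod.fst))
    (h2 : (l.map Prod.snd).Perm (l'.map Prod.snd)) : l = l' := by
  have e1 : l.map Prod.fst = l'.map Prod.fst :=
    h1.eq_of_pairwise' (List.pairwise_map.2 (hl.1.imp fun h => h.1))
      (List.pairwise_map.2 (hl'.1.imp fun h => h.1))
  have e2 : l.map Prod.snd = l'.map Prod.snd :=
    h2.eq_of_pairwise' (List.pairwise_map.2 (hl.1.imp fun h => h.2))
      (List.pairwise_map.2 (hl'.1.imp fun h => h.2))
  rw [← List.zip_unzip l, ← List.zip_unzip l', List.unzip_eq_map, List.unzip_eq_map]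
  simp only [e1, e2]

theorem IsStandard.eq_of_sum_xyExp {n : ℕ} {l l' : List (Fin n × Fin n)} (hl : IsStandard l)
    (hl' : IsStandard l') (h : (l.map xyExp).sum = (l'.map xyExp).sum) : l = l' := by
  refine hl.eq_of_perm hl' (List.perm_iff_count.2 fun i => ?_) (List.perm_iff_count.2 fun i => ?_)
  · rw [← sum_xyExp_inl, h, sum_xyExp_inl]
  · rw [← sum_xyExp_inr, h, sum_xyExp_inr]

/-- The standard products of minors are linearly independent. -/
theorem linearIndependent_standard (F : Type u) [Field F] (n : ℕ) :
    LinearIndependent F (fun l : {l : List (Fin n × Fin n) // IsStandard l} =>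
      (l.1.map fun p => minor F p.1 p.2).prod) := by
  refine linearIndependent_of_injective_degree (xyOrder n) _
    (fun l => (monic_prod_minor F l.1 l.2.2).1.ne_zero) fun l l' h => ?_
  simp only [(monic_prod_minor F l.1 l.2.2).2, (monic_prod_minor F l'.1 l'.2.2).2] at h
  exact Subtype.ext (l.2.eq_of_sum_xyExp l'.2 h)

/-- The standard lists all of whose second entries are at least `j`. -/
def StandardGE (n : ℕ) (j : Fin n) : Type :=
  {l : List (Fin n × Fin n) // IsStandard l ∧ ∀ p ∈ l, j ≤ p.2}

/-- The products `b y_j`, for standard products `b` of minors with second indices at least `j`,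
are linearly independent. -/
theorem linearIndependent_standard_mul_y (F : Type u) [Field F] (n : ℕ) :
    LinearIndependent F (fun x : Σ j : Fin n, StandardGE n j =>
      (x.2.1.map fun p => minor F p.1 p.2).prod * (MvPolynomial.X (Sum.inr x.1) : PolyXY F n)) := by
  have hdeg : ∀ x : Σ j : Fin n, StandardGE n j,
      (xyOrder n).degree ((x.2.1.map fun p => minor F p.1 p.2).prod *
        (MvPolynomial.X (Sum.inr x.1) : PolyXY F n)) =
      (x.2.1.map xyExp).sum + Finsupp.single (Sum.inr x.1) 1 := fun x => by
    obtain ⟨h1, h2⟩ := monic_prod_minor F x.2.1 x.2.2.1.2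
    rw [MonomialOrder.degree_mul h1.ne_zero (MvPolynomial.X_ne_zero _), h2, MonomialOrder.degree_X]
  refine linearIndependent_of_injective_degree (xyOrder n) _
    (fun x => mul_ne_zero (monic_prod_minor F x.2.1 x.2.2.1.2).1.ne_zero
      (MvPolynomial.X_ne_zero _)) fun x x' h => ?_
  simp only [hdeg] at h
  obtain ⟨j, l, hl, hj⟩ := x
  obtain ⟨j', l', hl', hj'⟩ := x'
  simp only at h
  have hy : (j :: l.map Prod.snd).Perm (j' :: l'.map Prod.snd) := by
    refine List.perm_iff_count.2 fun i => ?_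
    have := DFunLike.congr_fun h (Sum.inr i)
    simpa [sum_xyExp_inr, Finsupp.single_apply, List.count_cons] using this
  -- The y-part of the leading monomial gives the multiset consisting of j and the second indices of
  -- the list. As those are at least j, its minimum is j, so j can be recovered.
  have hle : ∀ {a b : Fin n} {k k' : List (Fin n × Fin n)}, (∀ p ∈ k', b ≤ p.2) →
      (a :: k.map Prod.snd).Perm (b :: k'.map Prod.snd) → b ≤ a := fun {a b k k'} hk h => by
    have ha : a ∈ b :: k'.map Prod.snd := h.subset (by simp)
    rcases List.mem_cons.1 ha with h | h
    · exact h.ge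
    · obtain ⟨p, hp, rfl⟩ := List.mem_map.1 h
      exact hk p hp
  obtain rfl : j = j' := le_antisymm (hle hj hy.symm) (hle hj' hy)
  obtain rfl := hl.eq_of_sum_xyExp hl' (add_right_cancel h)
  rfl

/-! ### Bases and presentations of `S_n` and `S_n V` -/

/-- The product of the `α_ij` over a list of pairs. -/
noncomputable def alphaProd (F : Type u) [Field F] {n : ℕ} (l : List (Fin n × Fin n)) : S F n :=
  (l.map fun p => alpha F p.1 p.2).prod

theorem coe_alphaProd (F : Type u) [Field F] {n : ℕ} (l : List (Fin n × Fin n)) :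
    (alphaProd F l : PolyXY F n) = (l.map fun p => minor F p.1 p.2).prod := by
  change (S F n).val _ = _
  rw [alphaProd, map_list_prod, List.map_map]
  rfl

theorem alpha_self (F : Type u) [Field F] {n : ℕ} (i : Fin n) : alpha F i i = 0 := by
  ext1; simp [alpha, minor]

theorem alpha_anti (F : Type u) [Field F] {n : ℕ} (i j : Fin n) : alpha F i j = -alpha F j i := by
  ext1; simp [alpha, minor]

theorem alpha_plucker (F : Type u) [Field F] {n : ℕ} (i j k l : Fin n) :
    alpha F i j * alpha F k l - alpha F i k * alpha F j l + alpha F i l * alpha F j k = 0 := by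
  ext1; simp only [alpha, minor, AddMemClass.coe_add, AddSubgroupClass.coe_sub, MulMemClass.coe_mul,
    ZeroMemClass.coe_zero]; ring

theorem alpha_smul_vecSV (F : Type u) [Field F] {n : ℕ} (i j k : Fin n) :
    alpha F i j • vecSV F k + alpha F j k • vecSV F i + alpha F k i • vecSV F j = 0 := by
  apply Subtype.ext
  change alpha F i j • vec F k + alpha F j k • vec F i + alpha F k i • vec F j = 0
  ext1 <;> simp [alpha, minor, vec, Subalgebra.smul_def] <;> ring

theorem adjoin_alpha (F : Type u) [Field F] (n : ℕ) :
    Algebra.adjoin F (Set.range fun p : Fin n × Fin n => alpha F p.1 p.2) = ⊤ := by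
  refine Eq.trans ?_ (Algebra.adjoin_adjoin_coe_preimage (R := F)
    (s := Set.range fun p : Fin n × Fin n => minor F p.1 p.2))
  congr 1
  ext x
  constructor
  · rintro ⟨p, rfl⟩
    exact ⟨p, rfl⟩
  · rintro ⟨p, hp⟩
    exact ⟨p, Subtype.ext hp⟩

theorem mem_span_alphaProd {F : Type u} [Field F] {n : ℕ} (s : S F n) :
    s ∈ Submodule.span F {x | ∃ l : List (Fin n × Fin n), IsStandard l ∧ x = alphaProd F l} := by
  refine adjoin_le_span_standard (alpha F) (alpha_self F) (alpha_anti F) (alpha_plucker F) ?_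
  rw [adjoin_alpha]
  trivial

theorem linearIndependent_alphaProd (F : Type u) [Field F] (n : ℕ) :
    LinearIndependent F (fun l : {l : List (Fin n × Fin n) // IsStandard l} =>
      alphaProd F l.1) := by
  refine LinearIndependent.of_comp (S F n).val.toLinearMap ?_
  have h := linearIndependent_standard F n
  simp only [← coe_alphaProd] at h
  exact h

/-- `S_n` is presented, as a commutative algebra, by the relations of `2 × 2` minors. -/
theorem exists_algHom_alpha {F : Type u} [Field F] {n : ℕ} {R : Type*} [CommRing R]
    [Algebra F R] (c : Fin n → Fin n → R) (hself : ∀ i, c i i = 0) (hanti : ∀ i j, c i j = -c j i)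
    (hc : ∀ i j k l, c i j * c k l - c i k * c j l + c i l * c j k = 0) :
    ∃ ψ : S F n →ₐ[F] R, ∀ i j, ψ (alpha F i j) = c i j := by
  -- The subalgebra `T` generated by the pairs (α_ij, c_ij) turns out to be the graph of the
  -- required map: its projection to `S_n` is bijective.
  let d : Fin n → Fin n → S F n × R := fun i j => (alpha F i j, c i j)
  let T := Algebra.adjoin F (Set.range fun p : Fin n × Fin n => d p.1 p.2)
  let g : T →ₐ[F] S F n := (AlgHom.fst F (S F n) R).comp T.val
  have hd : ∀ i j, d i j ∈ T := fun i j => Algebra.subset_adjoin ⟨(i, j), rfl⟩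
  have hsurj : Function.Surjective g := by
    rw [← AlgHom.range_eq_top, eq_top_iff, ← adjoin_alpha, Algebra.adjoin_le_iff]
    rintro _ ⟨p, rfl⟩
    exact ⟨⟨d p.1 p.2, hd _ _⟩, rfl⟩
  -- The pairs obey the same relations, so `T` is spanned by their standard products. These project
  -- to linearly independent elements, so the projection kills nothing.
  have hinj : Function.Injective g := by
    rw [injective_iff_map_eq_zero]
    rintro ⟨x, hx⟩ h
    have hx' := adjoin_le_span_standard d (fun i => Prod.ext (alpha_self F i) (hself i))
      (fun i j => Prod.ext (alpha_anti F i j) (hanti i j))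
      (fun i j k l => Prod.ext (alpha_plucker F i j k l) (hc i j k l)) hx
    have hfam : {x | ∃ l : List (Fin n × Fin n), IsStandard l ∧
        x = (l.map fun p => d p.1 p.2).prod} =
        Set.range fun l : {l : List (Fin n × Fin n) // IsStandard l} =>
          (l.1.map fun p => d p.1 p.2).prod := by
      ext y
      constructor
      · rintro ⟨l, hl, rfl⟩
        exact ⟨⟨l, hl⟩, rfl⟩
      · rintro ⟨l, rfl⟩
        exact ⟨l.1, l.2, rfl⟩
    rw [hfam] at hx'
    have hli : LinearIndependent F ((AlgHom.fst F (S F n) R).toLinearMap ∘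
        fun l : {l : List (Fin n × Fin n) // IsStandard l} =>
          (l.1.map fun p => d p.1 p.2).prod) := by
      convert linearIndependent_alphaProd F n using 2 with l
      simp only [Function.comp_apply, AlgHom.toLinearMap_apply, map_list_prod, List.map_map]
      rfl
    exact Subtype.ext (Submodule.disjoint_def.1 (Submodule.range_ker_disjoint hli) x hx' h)
  let e := AlgEquiv.ofBijective g ⟨hinj, hsurj⟩
  refine ⟨((AlgHom.snd F (S F n) R).comp T.val).comp e.symm.toAlgHom, fun i j => ?_⟩
  have : e.symm (alpha F i j) = ⟨d i j, hd i j⟩ := by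
    rw [AlgEquiv.symm_apply_eq]
    rfl
  change (e.symm (alpha F i j)).1.2 = c i j
  rw [this]

/-- If a factor α_ab of a standard product has b < j, the cyclic relation replaces α_ab v_j by -α_bj
v_a - α_ja v_b, where a < b < j. The new coefficients need not be standard, so the induction on j is
over all `s` at once. -/
theorem smul_mem_span_alphaProd_smul {F : Type u} [Field F] {n : ℕ} {M : Type*} [AddCommGroup M]
    [Module F M] [Module (S F n) M] [IsScalarTower F (S F n) M] (b : Fin n → M)
    (hb : ∀ i j k, alpha F i j • b k + alpha F j k • b i + alpha F k i • b j = 0)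
    (j : Fin n) (s : S F n) :
    s • b j ∈ Submodule.span F
      (Set.range fun x : Σ j : Fin n, StandardGE n j => alphaProd F x.2.1 • b x.1) := by
  induction j using WellFoundedLT.induction generalizing s with
  | _ j ih =>
  induction mem_span_alphaProd s using Submodule.span_induction with
  | zero => simp
  | add x y _ _ hx hy => rw [add_smul]; exact add_mem hx hy
  | smul a x _ hx => rw [smul_assoc]; exact Submodule.smul_mem _ _ hx
  | mem s hs =>
    obtain ⟨l, hl, rfl⟩ := hs
    by_cases hj : ∀ p ∈ l, j ≤ p.2
    · exact Submodule.subset_span ⟨⟨j, l, hl, hj⟩, rfl⟩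
    push Not at hj
    obtain ⟨p, hp, hpj⟩ := hj
    obtain ⟨l', hl'⟩ : ∃ l' : List (Fin n × Fin n), l.Perm (p :: l') :=
      ⟨_, List.perm_cons_erase hp⟩
    have e : alphaProd F l = alphaProd F l' * alpha F p.1 p.2 := by
      rw [alphaProd, (hl'.map _).prod_eq, List.map_cons, List.prod_cons, mul_comm, alphaProd]
    have e2 : alphaProd F l • b j = -((alphaProd F l' * alpha F p.2 j) • b p.1) -
        (alphaProd F l' * alpha F j p.1) • b p.2 := by
      rw [e, mul_smul, mul_smul, mul_smul, eq_sub_iff_add_eq, eq_neg_iff_add_eq_zero,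
        ← smul_add, ← smul_add, add_right_comm, hb, smul_zero]
    rw [e2]
    exact sub_mem (neg_mem (ih _ ((hl.2 p hp).trans hpj) _)) (ih _ hpj _)

theorem mem_span_alphaProd_smul {F : Type u} [Field F] {n : ℕ} {M : Type*} [AddCommGroup M]
    [Module F M] [Module (S F n) M] [IsScalarTower F (S F n) M] (b : Fin n → M)
    (hb : ∀ i j k, alpha F i j • b k + alpha F j k • b i + alpha F k i • b j = 0)
    {x : M} (hx : x ∈ Submodule.span (S F n) (Set.range b)) :
    x ∈ Submodule.span F
      (Set.range fun x : Σ j : Fin n, StandardGE n j => alphaProd F x.2.1 • b x.1) := by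
  obtain ⟨c, rfl⟩ := (Submodule.mem_span_range_iff_exists_fun _).1 hx
  exact sum_mem fun j _ => smul_mem_span_alphaProd_smul b hb j (c j)

/-- The elements `b v_j` with `b` standard with second indices at least `j` are linearly
independent. -/
theorem linearIndependent_alphaProd_smul_vecSV (F : Type u) [Field F] (n : ℕ) :
    LinearIndependent F (fun x : Σ j : Fin n, StandardGE n j =>
      alphaProd F x.2.1 • vecSV F x.1) := by
  -- The second coordinate of b v_j is b y_j; independence is already visible there.
  refine LinearIndependent.of_comp
    (LinearMap.snd F _ _ ∘ₗ ((SV F n).subtype.restrictScalars F)) ?_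
  have h := linearIndependent_standard_mul_y F n
  simp only [← coe_alphaProd] at h
  exact h

theorem span_vecSV (F : Type u) [Field F] (n : ℕ) :
    Submodule.span (S F n) (Set.range (vecSV F (n := n))) = ⊤ := by
  rw [eq_top_iff]
  rintro ⟨x, hx⟩ -
  obtain ⟨c, rfl⟩ := (Submodule.mem_span_range_iff_exists_fun _).1 hx
  refine (Submodule.mem_span_range_iff_exists_fun _).2 ⟨c, Subtype.ext ?_⟩
  rw [AddSubmonoidClass.coe_finsetSum]
  rfl

/-- The graph argument for modules: the submodule generated by the pairs (v_j, b_j) is spanned by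
straightened elements, and these are independent after projection to `P`. -/
theorem exists_linearMap_of_linearIndependent {F : Type u} [Field F] {n : ℕ} {P M : Type*}
    [AddCommGroup P] [Module F P] [Module (S F n) P] [IsScalarTower F (S F n) P]
    [AddCommGroup M] [Module F M] [Module (S F n) M] [IsScalarTower F (S F n) M]
    (v : Fin n → P) (b : Fin n → M)
    (hv : ∀ i j k, alpha F i j • v k + alpha F j k • v i + alpha F k i • v j = 0)
    (hb : ∀ i j k, alpha F i j • b k + alpha F j k • b i + alpha F k i • b j = 0)
    (hspan : Submodule.span (S F n) (Set.range v) = ⊤)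
    (hli : LinearIndependent F
      (fun x : Σ j : Fin n, StandardGE n j => alphaProd F x.2.1 • v x.1)) :
    ∃ χ : P →ₗ[S F n] M, ∀ j, χ (v j) = b j := by
  let d : Fin n → P × M := fun j => (v j, b j)
  let N := Submodule.span (S F n) (Set.range d)
  let g : N →ₗ[S F n] P := (LinearMap.fst (S F n) P M).comp N.subtype
  have hd : ∀ j, d j ∈ N := fun j => Submodule.subset_span ⟨j, rfl⟩
  have hsurj : Function.Surjective g := by
    rw [← LinearMap.range_eq_top, eq_top_iff, ← hspan, Submodule.span_le]
    rintro _ ⟨j, rfl⟩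
    exact ⟨⟨d j, hd j⟩, rfl⟩
  have hinj : Function.Injective g := by
    rw [injective_iff_map_eq_zero]
    rintro ⟨x, hx⟩ h
    have hx' := mem_span_alphaProd_smul d (fun i j k => Prod.ext (hv i j k) (hb i j k)) hx
    have hli : LinearIndependent F ((LinearMap.fst F P M) ∘
        fun x : Σ j : Fin n, StandardGE n j => alphaProd F x.2.1 • d x.1) := hli
    exact Subtype.ext (Submodule.disjoint_def.1 (Submodule.range_ker_disjoint hli) x hx' h)
  let e := LinearEquiv.ofBijective g ⟨hinj, hsurj⟩
  refine ⟨((LinearMap.snd (S F n) P M).comp N.subtype).comp e.symm.toLinearMap, fun j => ?_⟩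
  have : e.symm (v j) = ⟨d j, hd j⟩ := by
    rw [LinearEquiv.symm_apply_eq]
    rfl
  change (e.symm (v j)).1.2 = b j
  rw [this]

/-- `S_n V` is presented, as an `S_n`-module, by the cyclic relations. -/
theorem exists_linearMap_vecSV {F : Type u} [Field F] {n : ℕ} {M : Type*} [AddCommGroup M]
    [Module F M] [Module (S F n) M] [IsScalarTower F (S F n) M] (b : Fin n → M)
    (hb : ∀ i j k, alpha F i j • b k + alpha F j k • b i + alpha F k i • b j = 0) :
    ∃ χ : SV F n →ₗ[S F n] M, ∀ j, χ (vecSV F j) = b j :=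
  exists_linearMap_of_linearIndependent (vecSV F) b (alpha_smul_vecSV F) hb (span_vecSV F n)
    (linearIndependent_alphaProd_smul_vecSV F n)

/-! ### The sets `B_{n,j}` and the direct decomposition of `S_n V` -/

theorem mem_B_iff {F : Type u} [Field F] {n : ℕ} {j : Fin n} {b : S F n} :
    b ∈ B F j ↔ ∃ l : StandardGE n j, alphaProd F l.1 = b := by
  constructor
  · rintro ⟨r, i, k, hi, hk, hik, hj, rfl⟩
    refine ⟨⟨List.ofFn fun s => (i s, k s), ⟨?_, ?_⟩, ?_⟩, ?_⟩
    · rw [List.pairwise_ofFn]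
      exact fun s s' h => ⟨hi h.le, hk h.le⟩
    · intro p hp
      obtain ⟨s, rfl⟩ := (List.mem_ofFn' _ _).1 hp
      exact hik s
    · intro p hp
      obtain ⟨s, rfl⟩ := (List.mem_ofFn' _ _).1 hp
      exact hj s
    · rw [alphaProd, List.map_ofFn, List.prod_ofFn]
      rfl
  · rintro ⟨⟨l, hl, hj⟩, rfl⟩
    have hmono : Monotone fun s : Fin l.length => l.get s := by
      intro s s' h
      rcases h.eq_or_lt with rfl | h
      · exact le_rfl
      · exact List.pairwise_iff_get.1 hl.1 s s' h
    refine ⟨l.length, fun s => (l.get s).1, fun s => (l.get s).2, fun s s' h => (hmono h).1,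
      fun s s' h => (hmono h).2, fun s => hl.2 _ (l.get_mem s), fun s => hj _ (l.get_mem s), ?_⟩
    rw [← List.prod_ofFn, alphaProd]
    congr 1
    exact (congrArg _ (List.ofFn_get l).symm).trans List.map_ofFn

/-- The index here is a set of elements of `S_n`, not of lists; choosing a standard list for each
element embeds it into the independent family. -/
theorem linearIndependent_B (F : Type u) [Field F] {n : ℕ} (j : Fin n) :
    LinearIndependent F (fun b : B F j => (b : S F n) • vecSV F j) := by
  choose l hl using fun b : B F j => mem_B_iff.1 b.2
  have h := (linearIndependent_alphaProd_smul_vecSV F n).comp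
    (fun b : B F j => (⟨j, l b⟩ : Σ j : Fin n, StandardGE n j)) fun b b' hbb' => by
      obtain rfl | h := eq_or_ne b b'
      · rfl
      · have := eq_of_heq (Sigma.mk.inj hbb').2
        exact Subtype.ext (by rw [← hl b, ← hl b', this])
  convert h using 2 with b
  rw [Function.comp_apply, hl]

theorem BV_eq_span_image (F : Type u) [Field F] {n : ℕ} (j : Fin n) :
    BV F j = Submodule.span F ((fun x : Σ j : Fin n, StandardGE n j =>
      alphaProd F x.2.1 • vecSV F x.1) '' {x | x.1 = j}) := by
  rw [BV]
  congr 1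
  ext y
  constructor
  · rintro ⟨b, hb, rfl⟩
    obtain ⟨l, rfl⟩ := mem_B_iff.1 hb
    exact ⟨⟨j, l⟩, rfl, rfl⟩
  · rintro ⟨⟨_, l⟩, rfl, rfl⟩
    exact ⟨_, mem_B_iff.2 ⟨l, rfl⟩, rfl⟩

theorem _root_.LinearIndependent.isInternal_span_sigma {F M ι : Type*} {κ : ι → Type*}
    [DecidableEq ι] [Field F] [AddCommGroup M] [Module F M] {v : (Σ j, κ j) → M}
    (hli : LinearIndependent F v)
    (hspan : ∀ x, x ∈ Submodule.span F (Set.range v)) :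
    DirectSum.IsInternal fun j => Submodule.span F (v '' {x | x.1 = j}) := by
  rw [DirectSum.isInternal_submodule_iff_iSupIndep_and_iSup_eq_top]
  constructor
  · intro j
    refine (hli.disjoint_span_image (s := {x | x.1 = j}) (t := {x | x.1 ≠ j}) ?_).mono_right ?_
    · rw [Set.disjoint_left]
      exact fun x h h' => h' h
    · refine iSup₂_le fun k hk => Submodule.span_mono (Set.image_mono fun x hx => ?_)
      rw [Set.mem_ofPred_eq] at hx ⊢
      rwa [hx]
  · rw [eq_top_iff]
    refine fun x _ => Submodule.span_le.2 ?_ (hspan x)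
    rintro _ ⟨x, rfl⟩
    exact Submodule.mem_iSup_of_mem x.1 (Submodule.subset_span ⟨x, rfl, rfl⟩)

theorem isInternal_BV (F : Type u) [Field F] (n : ℕ) :
    DirectSum.IsInternal (fun j : Fin n => BV F j) := by
  have hspan := fun x : SV F n => mem_span_alphaProd_smul (F := F) (M := SV F n) (vecSV F)
    (alpha_smul_vecSV F) (Submodule.eq_top_iff'.1 (span_vecSV F n) x)
  have h := LinearIndependent.isInternal_span_sigma (F := F) (M := SV F n)
    (linearIndependent_alphaProd_smul_vecSV F n) hspan
  rw [show (fun j : Fin n => BV F j) = _ from funext fun j => BV_eq_span_image F j]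
  exact h

/-! ### The model is a `Γ`-algebra -/

theorem augMul_comm {F : Type u} [Field F] {n : ℕ} (s s' : SAug F n) :
    augMul F n s s' = augMul F n s' s := by
  apply Subtype.ext; apply Subtype.ext
  simp only [coe_augMul]; ring

theorem augMul_assoc {F : Type u} [Field F] {n : ℕ} (s s' s'' : SAug F n) :
    augMul F n (augMul F n s s') s'' = augMul F n s (augMul F n s' s'') := by
  apply Subtype.ext; apply Subtype.ext
  simp only [coe_augMul]; ring

theorem augAct_augMul {F : Type u} [Field F] {n : ℕ} (s s' : SAug F n) (p : SV F n) :
    augAct F n (augMul F n s s') p = augAct F n s (augAct F n s' p) := by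
  apply Subtype.ext
  ext1 <;> simp only [coe_augAct, coe_augMul] <;> ring

theorem oddForm_augAct_left {F : Type u} [Field F] {n : ℕ} (s : SAug F n) (p q : SV F n) :
    oddForm F n (augAct F n s p) q = augMul F n s (oddForm F n p q) := by
  apply Subtype.ext; apply Subtype.ext
  simp only [coe_oddForm, coe_augMul, coe_augAct, wedge]; ring

theorem oddForm_add_oddForm {F : Type u} [Field F] {n : ℕ} (p q : SV F n) :
    oddForm F n p q + oddForm F n q p = 0 := by
  apply Subtype.ext; apply Subtype.ext
  change wedge p.1 q.1 + wedge q.1 p.1 = 0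
  simp only [wedge]; ring

theorem oddForm_self {F : Type u} [Field F] {n : ℕ} (p : SV F n) : oddForm F n p p = 0 := by
  apply Subtype.ext; apply Subtype.ext
  change wedge p.1 p.1 = 0
  simp only [wedge]; ring

/-- This is Cramer's rule for three vectors in the plane. -/
theorem augAct_oddForm_cyclic {F : Type u} [Field F] {n : ℕ} (p q r : SV F n) :
    augAct F n (oddForm F n p q) r + augAct F n (oddForm F n q r) p +
      augAct F n (oddForm F n r p) q = 0 := by
  apply Subtype.ext
  change (augAct F n (oddForm F n p q) r).1 + (augAct F n (oddForm F n q r) p).1 +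
      (augAct F n (oddForm F n r p) q).1 = 0
  simp only [coe_augAct, coe_oddForm, wedge]
  ext1 <;> simp only [Prod.fst_add, Prod.snd_add, Prod.fst_zero, Prod.snd_zero] <;> ring

theorem oddForm_vecSV {F : Type u} [Field F] {n : ℕ} (i j : Fin n) :
    oddForm F n (vecSV F i) (vecSV F j) = alphaAug F i j :=
  Subtype.ext (Subtype.ext (wedge_vec i j))

namespace Model

section
variable {F : Type u} [Field F] {m n : ℕ}

theorem ofFree_mul_ofFree (f g : FreeT F m) :
    ofFree F m n f * ofFree F m n g = ofFree F m n (f * g) := by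
  ext1 <;> simp [mul_free, mul_aug, mul_odd, ofFree_apply]

theorem ofFree_mul_ofAug (f : FreeT F m) (g : PolyT F m) (s : SAug F n) :
    ofFree F m n f * ofAug F m n (g ⊗ₜ s) = ofAug F m n ((bar F m f * g) ⊗ₜ s) := by
  ext1 <;> simp [mul_free, mul_aug, mul_odd, ofFree_apply, ofAug_apply, TensorProduct.smul_tmul']

theorem ofAug_mul_ofFree (f : FreeT F m) (g : PolyT F m) (s : SAug F n) :
    ofAug F m n (g ⊗ₜ s) * ofFree F m n f = ofAug F m n ((bar F m f * g) ⊗ₜ s) := by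
  ext1 <;> simp [mul_free, mul_aug, mul_odd, ofFree_apply, ofAug_apply, TensorProduct.smul_tmul']

theorem ofFree_mul_ofOdd (f : FreeT F m) (g : PolyT F m) (p : SV F n) :
    ofFree F m n f * ofOdd F m n (g ⊗ₜ p) = ofOdd F m n ((bar F m f * g) ⊗ₜ p) := by
  ext1 <;> simp [mul_free, mul_aug, mul_odd, ofFree_apply, ofOdd_apply, TensorProduct.smul_tmul']

theorem ofOdd_mul_ofFree (f : FreeT F m) (g : PolyT F m) (p : SV F n) :
    ofOdd F m n (g ⊗ₜ p) * ofFree F m n f = ofOdd F m n ((bar F m f * g) ⊗ₜ p) := by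
  ext1 <;> simp [mul_free, mul_aug, mul_odd, ofFree_apply, ofOdd_apply, TensorProduct.smul_tmul']

theorem ofAug_mul_ofAug (g h : PolyT F m) (s s' : SAug F n) :
    ofAug F m n (g ⊗ₜ s) * ofAug F m n (h ⊗ₜ s') = ofAug F m n ((g * h) ⊗ₜ augMul F n s s') := by
  ext1 <;> simp [mul_free, mul_aug, mul_odd, ofAug_apply]

theorem ofAug_mul_ofOdd (g h : PolyT F m) (s : SAug F n) (p : SV F n) :
    ofAug F m n (g ⊗ₜ s) * ofOdd F m n (h ⊗ₜ p) = ofOdd F m n ((g * h) ⊗ₜ augAct F n s p) := by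
  ext1 <;> simp [mul_free, mul_aug, mul_odd, ofAug_apply, ofOdd_apply]

theorem ofOdd_mul_ofAug (g h : PolyT F m) (s : SAug F n) (p : SV F n) :
    ofOdd F m n (h ⊗ₜ p) * ofAug F m n (g ⊗ₜ s) = ofOdd F m n ((g * h) ⊗ₜ augAct F n s p) := by
  ext1 <;> simp [mul_free, mul_aug, mul_odd, ofAug_apply, ofOdd_apply]

theorem ofOdd_mul_ofOdd (g h : PolyT F m) (p q : SV F n) :
    ofOdd F m n (g ⊗ₜ p) * ofOdd F m n (h ⊗ₜ q) =
      ofAug F m n ((g * h) ⊗ₜ oddForm F n p q) := by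
  ext1 <;> simp [mul_free, mul_aug, mul_odd, ofAug_apply, ofOdd_apply]

theorem ofFree_mem (f : FreeT F m) : ofFree F m n f ∈ grading F m n 0 :=
  Submodule.mem_sup_left ⟨f, rfl⟩

theorem ofAug_mem (z : PolyT F m ⊗[F] SAug F n) : ofAug F m n z ∈ grading F m n 0 :=
  Submodule.mem_sup_right ⟨z, rfl⟩

theorem ofOdd_mem (z : PolyT F m ⊗[F] SV F n) : ofOdd F m n z ∈ grading F m n 1 :=
  ⟨z, rfl⟩

@[elab_as_elim]
theorem odd_induction {P : Model F m n → Prop} (odd : ∀ g p, P (ofOdd F m n (g ⊗ₜ p)))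
    (add : ∀ x y, P x → P y → P (x + y)) (x : Model F m n) (hx : x ∈ grading F m n 1) : P x := by
  obtain ⟨z, rfl⟩ := hx
  induction z using TensorProduct.induction_on with
  | zero => simpa using odd 0 0
  | tmul g p => exact odd g p
  | add z z' h h' => rw [map_add]; exact add _ _ h h'

@[elab_as_elim]
theorem even_induction {P : Model F m n → Prop} (free : ∀ f, P (ofFree F m n f))
    (aug : ∀ g s, P (ofAug F m n (g ⊗ₜ s)))
    (add : ∀ x y, P x → P y → P (x + y)) (x : Model F m n)
    (hx : x ∈ grading F m n 0) : P x := by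
  obtain ⟨_, ⟨f, rfl⟩, _, ⟨z, rfl⟩, rfl⟩ := Submodule.mem_sup.1 hx
  refine add _ _ (free f) ?_
  clear hx
  induction z using TensorProduct.induction_on with
  | zero => simpa using aug 0 0
  | tmul g p => exact aug g p
  | add z z' h h' => rw [map_add]; exact add _ _ h h'

theorem eq_add (x : Model F m n) :
    x = ofFree F m n x.free + ofAug F m n x.aug + ofOdd F m n x.odd := by
  ext1 <;> simp [add_free, add_aug, add_odd, ofFree_apply, ofAug_apply, ofOdd_apply]

@[elab_as_elim]
theorem induction_tmul {P : Model F m n → Prop} (free : ∀ f, P (ofFree F m n f))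
    (aug : ∀ g s, P (ofAug F m n (g ⊗ₜ s))) (odd : ∀ g p, P (ofOdd F m n (g ⊗ₜ p)))
    (add : ∀ x y, P x → P y → P (x + y)) (x : Model F m n) : P x := by
  rw [eq_add x]
  exact add _ _ (even_induction free aug add _ (add_mem (ofFree_mem _) (ofAug_mem _)))
    (odd_induction odd add _ (ofOdd_mem _))

theorem isInternal_grading : DirectSum.IsInternal (grading F m n) := by
  rw [DirectSum.isInternal_submodule_iff_isCompl (grading F m n) (i := 0) (j := 1) (by decide)
    (by
      have h : ∀ i : ZMod 2, i = 0 ∨ i = 1 := by decide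
      ext i; simpa using h i)]
  rw [isCompl_iff, Submodule.disjoint_def, codisjoint_iff, eq_top_iff]
  constructor
  · rintro x hx ⟨z, rfl⟩
    obtain ⟨_, ⟨f, rfl⟩, _, ⟨z', rfl⟩, h⟩ := Submodule.mem_sup.1 hx
    have := congrArg Model.odd h
    simp only [ofFree_apply, ofAug_apply, ofOdd_apply, add_odd, add_zero] at this
    rw [← this]
    exact map_zero (ofOdd F m n)
  · intro x _
    rw [eq_add x]
    exact Submodule.add_mem_sup (add_mem (ofFree_mem _) (ofAug_mem _)) (ofOdd_mem _)

theorem mul_mem_grading (i j : ZMod 2) (x : Model F m n) (hx : x ∈ grading F m n i)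
    (y : Model F m n) (hy : y ∈ grading F m n j) : x * y ∈ grading F m n (i + j) := by
  have hij : ∀ i : ZMod 2, i = 0 ∨ i = 1 := by decide
  obtain rfl | rfl := hij i <;> obtain rfl | rfl := hij j
  · change _ ∈ grading F m n 0
    refine even_induction (fun f => ?_) (fun g s => ?_)
      (fun x x' h h' => by rw [add_mul]; exact add_mem h h') x hx <;>
    refine even_induction (fun f' => ?_) (fun g' s' => ?_)
      (fun x x' h h' => by rw [mul_add]; exact add_mem h h') y hy
    · rw [ofFree_mul_ofFree]; exact ofFree_mem _
    · rw [ofFree_mul_ofAug]; exact ofAug_mem _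
    · rw [ofAug_mul_ofFree]; exact ofAug_mem _
    · rw [ofAug_mul_ofAug]; exact ofAug_mem _
  · change _ ∈ grading F m n 1
    refine even_induction (fun f => ?_) (fun g s => ?_)
      (fun x x' h h' => by rw [add_mul]; exact add_mem h h') x hx <;>
    refine odd_induction (fun g' p => ?_)
      (fun x x' h h' => by rw [mul_add]; exact add_mem h h') y hy
    · rw [ofFree_mul_ofOdd]; exact ofOdd_mem _
    · rw [ofAug_mul_ofOdd]; exact ofOdd_mem _
  · change _ ∈ grading F m n 1
    refine odd_induction (fun g p => ?_)
      (fun x x' h h' => by rw [add_mul]; exact add_mem h h') x hx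
    refine even_induction (fun f' => ?_) (fun g' s' => ?_)
      (fun x x' h h' => by rw [mul_add]; exact add_mem h h') y hy
    · rw [ofOdd_mul_ofFree]; exact ofOdd_mem _
    · rw [ofOdd_mul_ofAug]; exact ofOdd_mem _
  · change _ ∈ grading F m n 0
    refine odd_induction (fun g p => ?_)
      (fun x x' h h' => by rw [add_mul]; exact add_mem h h') x hx
    refine odd_induction (fun g' p' => ?_)
      (fun x x' h h' => by rw [mul_add]; exact add_mem h h') y hy
    rw [ofOdd_mul_ofOdd]; exact ofAug_mem _

theorem even_assoc (a : Model F m n) (ha : a ∈ grading F m n 0) (x y : Model F m n) :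
    (a * x) * y = a * (x * y) := by
  refine even_induction (fun f => ?_) (fun g s => ?_)
    (fun a a' h h' => by simp only [add_mul, h, h']) a ha <;>
  refine induction_tmul (fun f' => ?_) (fun g' s' => ?_) (fun g' p' => ?_)
    (fun x x' h h' => by simp only [add_mul, mul_add, h, h']) x <;>
  refine induction_tmul (fun f'' => ?_) (fun g'' s'' => ?_) (fun g'' p'' => ?_)
    (fun x x' h h' => by simp only [mul_add, h, h']) y <;>
  simp only [ofFree_mul_ofFree, ofFree_mul_ofAug, ofAug_mul_ofFree, ofFree_mul_ofOdd,
    ofOdd_mul_ofFree, ofAug_mul_ofAug, ofAug_mul_ofOdd, ofOdd_mul_ofAug, ofOdd_mul_ofOdd,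
    map_mul, mul_assoc, mul_comm, mul_left_comm, augMul_assoc, augAct_augMul,
    oddForm_augAct_left]
  -- The case left is `a` and `y` in the summand of `S_n'` and `x` odd: the actions of two elements
  -- of `S_n'` on `S_n V` commute.
  rw [← augAct_augMul, augMul_comm, augAct_augMul]

theorem even_odd_comm (a : Model F m n) (ha : a ∈ grading F m n 0) (x : Model F m n)
    (hx : x ∈ grading F m n 1) : a * x = x * a := by
  refine odd_induction (fun g p => ?_)
    (fun x x' h h' => by simp only [add_mul, mul_add, h, h']) x hx
  refine even_induction (fun f => ?_) (fun g s => ?_)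
    (fun a a' h h' => by simp only [add_mul, mul_add, h, h']) a ha
  · rw [ofFree_mul_ofOdd, ofOdd_mul_ofFree]
  · rw [ofAug_mul_ofOdd, ofOdd_mul_ofAug]

theorem odd_mul_odd_central (x : Model F m n) (hx : x ∈ grading F m n 1) (y : Model F m n)
    (hy : y ∈ grading F m n 1) (a : Model F m n) (ha : a ∈ grading F m n 0) :
    (x * y) * a = a * (x * y) := by
  refine odd_induction (fun g p => ?_)
    (fun x x' h h' => by simp only [add_mul, mul_add, h, h']) x hx
  refine odd_induction (fun g' p' => ?_)
    (fun x x' h h' => by simp only [add_mul, mul_add, h, h']) y hy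
  refine even_induction (fun f => ?_) (fun g s => ?_)
    (fun a a' h h' => by simp only [add_mul, mul_add, h, h']) a ha
  · rw [ofOdd_mul_ofOdd, ofFree_mul_ofAug, ofAug_mul_ofFree]
  · rw [ofOdd_mul_ofOdd, ofAug_mul_ofAug, ofAug_mul_ofAug, augMul_comm, mul_comm g]

theorem odd_anticomm (x : Model F m n) (hx : x ∈ grading F m n 1) (y : Model F m n)
    (hy : y ∈ grading F m n 1) : x * y + y * x = 0 := by
  refine odd_induction (fun g p => ?_) (fun x x' h h' => by
    rw [add_mul, mul_add, add_add_add_comm, h, h', add_zero]) x hx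
  refine odd_induction (fun g' p' => ?_) (fun x x' h h' => by
    rw [add_mul, mul_add, add_add_add_comm, h, h', add_zero]) y hy
  rw [ofOdd_mul_ofOdd, ofOdd_mul_ofOdd, mul_comm g, ← map_add, ← TensorProduct.tmul_add,
    oddForm_add_oddForm, TensorProduct.tmul_zero, map_zero]

theorem odd_mul_self (x : Model F m n) (hx : x ∈ grading F m n 1) : x * x = 0 := by
  -- Squaring is not additive. Membership is carried along so that the cross terms of (x + x')²
  -- cancel by anticommutativity.
  refine (odd_induction (P := fun x => x ∈ grading F m n 1 ∧ x * x = 0) (fun g p => ?_)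
    (fun x x' h h' => ⟨add_mem h.1 h'.1, ?_⟩) x hx).2
  · refine ⟨ofOdd_mem _, ?_⟩
    rw [ofOdd_mul_ofOdd, oddForm_self, TensorProduct.tmul_zero, map_zero]
  · rw [add_mul, mul_add, mul_add, h.2, h'.2, zero_add, add_zero, odd_anticomm x h.1 x' h'.1]

theorem odd_cyclic (x : Model F m n) (hx : x ∈ grading F m n 1) (y : Model F m n)
    (hy : y ∈ grading F m n 1) (z : Model F m n) (hz : z ∈ grading F m n 1) :
    (x * y) * z + (y * z) * x + (z * x) * y = 0 := by
  have key : ∀ a b c a' b' c' : Model F m n, a + b + c = 0 → a' + b' + c' = 0 →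
      (a + a') + (b + b') + (c + c') = 0 := fun a b c a' b' c' h h' => by
    rw [show (a + a') + (b + b') + (c + c') = (a + b + c) + (a' + b' + c') by abel, h, h', add_zero]
  refine odd_induction (fun g p => ?_)
    (fun x x' h h' => by simp only [add_mul, mul_add]; exact key _ _ _ _ _ _ h h') x hx
  refine odd_induction (fun g' q => ?_)
    (fun x x' h h' => by simp only [add_mul, mul_add]; exact key _ _ _ _ _ _ h h') y hy
  refine odd_induction (fun g'' r => ?_)
    (fun x x' h h' => by simp only [add_mul, mul_add]; exact key _ _ _ _ _ _ h h') z hz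
  simp only [ofOdd_mul_ofOdd, ofAug_mul_ofOdd]
  rw [show g' * g'' * g = g * g' * g'' by ring, show g'' * g * g' = g * g' * g'' by ring,
    ← map_add, ← map_add, ← TensorProduct.tmul_add, ← TensorProduct.tmul_add,
    augAct_oddForm_cyclic, TensorProduct.tmul_zero, map_zero]

theorem isGammaAlgebra (F : Type u) [Field F] (m n : ℕ) : IsGammaAlgebra F (grading F m n) where
  isInternal := isInternal_grading
  one_mem := ofFree_mem 1
  mul_mem := mul_mem_grading
  assoc := even_assoc
  even_odd_comm := even_odd_comm
  odd_mul_odd_central := odd_mul_odd_central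
  odd_anticomm := odd_anticomm
  odd_mul_self := odd_mul_self
  odd_cyclic := odd_cyclic

end

end Model

/-! ### Generation by `t_i` and `v_j` -/

theorem bar_surjective (F : Type u) [Field F] (m : ℕ) : Function.Surjective (bar F m) := by
  rw [← AlgHom.range_eq_top, eq_top_iff, ← MvPolynomial.adjoin_range_X, Algebra.adjoin_le_iff]
  rintro _ ⟨i, rfl⟩
  exact ⟨FreeAlgebra.ι F i, by simp [bar]⟩

@[elab_as_elim]
theorem S_induction {F : Type u} [Field F] {n : ℕ} {P : S F n → Prop}
    (alpha : ∀ i j, P (alpha F i j)) (algebraMap : ∀ c, P (algebraMap F _ c))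
    (add : ∀ s t, P s → P t → P (s + t)) (mul : ∀ s t, P s → P t → P (s * t)) (s : S F n) :
    P s := by
  have hs : s ∈ Algebra.adjoin F (Set.range fun p : Fin n × Fin n => GammaAlg.alpha F p.1 p.2) := by
    rw [adjoin_alpha]; exact Algebra.mem_top
  induction hs using Algebra.adjoin_induction with
  | mem x hx => obtain ⟨p, rfl⟩ := hx; exact alpha _ _
  | algebraMap r => exact algebraMap r
  | add x y _ _ hx hy => exact add _ _ hx hy
  | mul x y _ _ hx hy => exact mul _ _ hx hy

@[elab_as_elim]
theorem SV_induction {F : Type u} [Field F] {n : ℕ} {P : SV F n → Prop}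
    (vec : ∀ i, P (vecSV F i)) (zero : P 0) (add : ∀ p q, P p → P q → P (p + q))
    (smul : ∀ (s : S F n) p, P p → P (s • p)) (p : SV F n) : P p := by
  induction Submodule.eq_top_iff'.1 (span_vecSV F n) p using Submodule.span_induction with
  | mem x hx => obtain ⟨i, rfl⟩ := hx; exact vec i
  | zero => exact zero
  | add x y _ _ hx hy => exact add _ _ hx hy
  | smul s x _ hx => exact smul _ _ hx

/-- Modulo the ideal generated by the α_ij every element of `S_n` is a scalar, and the constant term
detects that scalar. -/
theorem SAug_eq_span (F : Type u) [Field F] (n : ℕ) :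
    SAug F n = Ideal.span (Set.range fun p : Fin n × Fin n => alpha F p.1 p.2) := by
  have hle : Ideal.span (Set.range fun p : Fin n × Fin n => alpha F p.1 p.2) ≤ SAug F n := by
    rw [Ideal.span_le]
    rintro _ ⟨p, rfl⟩
    exact alpha_mem_SAug F _ _
  refine le_antisymm (fun s hs => ?_) hle
  set I := Ideal.span (Set.range fun p : Fin n × Fin n => alpha F p.1 p.2)
  have key : ∃ c : F, s - algebraMap F _ c ∈ I := by
    clear hs
    induction s using S_induction with
    | alpha i j =>
      have h : alpha F i j ∈ I := Ideal.subset_span ⟨(i, j), rfl⟩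
      exact ⟨0, by rwa [map_zero, sub_zero]⟩
    | algebraMap c => exact ⟨c, by simp⟩
    | add s t hs ht =>
      obtain ⟨c, hc⟩ := hs
      obtain ⟨d, hd⟩ := ht
      exact ⟨c + d, by rw [map_add, add_sub_add_comm]; exact add_mem hc hd⟩
    | mul s t hs ht =>
      obtain ⟨c, hc⟩ := hs
      obtain ⟨d, hd⟩ := ht
      refine ⟨c * d, ?_⟩
      have : s * t - algebraMap F (S F n) (c * d) =
          s * (t - algebraMap F _ d) + algebraMap F _ d * (s - algebraMap F _ c) := by
        rw [map_mul]; ring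
      rw [this]
      exact add_mem (I.mul_mem_left _ hd) (I.mul_mem_left _ hc)
  obtain ⟨c, hc⟩ := key
  have h := (SAug F n).sub_mem hs (hle hc)
  rw [sub_sub_cancel, SAug, RingHom.mem_ker] at h
  have h' : MvPolynomial.constantCoeff (MvPolynomial.C (σ := Fin n ⊕ Fin n) c) = 0 := h
  rw [MvPolynomial.constantCoeff_C] at h'
  simpa [h'] using hc

@[elab_as_elim]
theorem SAug_induction {F : Type u} [Field F] {n : ℕ} {P : SAug F n → Prop}
    (smul : ∀ (s : S F n) i j, P (s • alphaAug F i j)) (zero : P 0)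
    (add : ∀ s t, P s → P t → P (s + t)) (s : SAug F n) : P s := by
  obtain ⟨s, hs⟩ := s
  have hs' := hs
  rw [SAug_eq_span] at hs'
  obtain ⟨c, rfl⟩ := (Submodule.mem_span_range_iff_exists_fun _).1 hs'
  have : (⟨_, hs⟩ : SAug F n) = ∑ p : Fin n × Fin n, c p • alphaAug F p.1 p.2 := by
    apply Subtype.ext
    rw [AddSubmonoidClass.coe_finsetSum]
    rfl
  rw [this]
  exact Finset.sum_induction _ P add zero fun p _ => smul _ _ _

theorem oddForm_smul_left {F : Type u} [Field F] {n : ℕ} (s : S F n) (p q : SV F n) :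
    oddForm F n (s • p) q = s • oddForm F n p q := by
  apply Subtype.ext; apply Subtype.ext
  change wedge (s • p.1) q.1 = (s : PolyXY F n) * wedge p.1 q.1
  simp only [wedge, Prod.smul_fst, Prod.smul_snd, Subalgebra.smul_def, smul_eq_mul]; ring

theorem oddForm_smul_right {F : Type u} [Field F] {n : ℕ} (s : S F n) (p q : SV F n) :
    oddForm F n p (s • q) = s • oddForm F n p q := by
  apply Subtype.ext; apply Subtype.ext
  change wedge p.1 (s • q.1) = (s : PolyXY F n) * wedge p.1 q.1
  simp only [wedge, Prod.smul_fst, Prod.smul_snd, Subalgebra.smul_def, smul_eq_mul]; ring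

theorem augAct_alphaAug {F : Type u} [Field F] {n : ℕ} (i j : Fin n) (p : SV F n) :
    augAct F n (alphaAug F i j) p = alpha F i j • p := rfl

namespace Model

variable {F : Type u} [Field F] {m n : ℕ}

theorem genV_mul_genV (i j : Fin n) :
    genV F m i * genV F m j = ofAug F m n (1 ⊗ₜ alphaAug F i j) := by
  rw [genV, genV, ofOdd_mul_ofOdd, oddForm_vecSV, mul_one]

/-- Unital homomorphisms from the model are determined by the images of the generators. -/
theorem hom_ext {H : Type w} [NonAssocRing H] [Module F H] {φ φ' : Model F m n →ₙₐ[F] H}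
    (h1 : φ 1 = φ' 1) (ht : ∀ i, φ (genT F n i) = φ' (genT F n i))
    (hv : ∀ j, φ (genV F m j) = φ' (genV F m j)) : φ = φ' := by
  have hfree : ∀ f, φ (ofFree F m n f) = φ' (ofFree F m n f) := by
    intro f
    induction f using FreeAlgebra.induction with
    | grade0 r =>
      rw [Algebra.algebraMap_eq_smul_one, map_smul, map_smul φ, map_smul φ']
      exact congrArg (r • ·) h1
    | grade1 i => exact ht i
    | mul f g hf hg => rw [← ofFree_mul_ofFree, map_mul, map_mul, hf, hg]
    | add f g hf hg => rw [map_add, map_add φ, map_add φ', hf, hg]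
  -- Only `S_n'` embeds in the model, so agreement is propagated along generators of `S_n`: α_ij
  -- acts as multiplication by v_i v_j, and constants act as scalars. Keeping `p` general lets
  -- products in `S_n` be handled by composition.
  have hsmul : ∀ (s : S F n) (p : SV F n), φ (ofOdd F m n (1 ⊗ₜ p)) = φ' (ofOdd F m n (1 ⊗ₜ p)) →
      φ (ofOdd F m n (1 ⊗ₜ (s • p))) = φ' (ofOdd F m n (1 ⊗ₜ (s • p))) := by
    intro s
    induction s using S_induction with
    | alpha i j =>
      intro p hp
      rw [← augAct_alphaAug, ← mul_one (1 : PolyT F m), ← ofAug_mul_ofOdd, ← genV_mul_genV]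
      simp only [map_mul, hp, hv]
    | algebraMap c =>
      intro p hp
      rw [algebraMap_smul, TensorProduct.tmul_smul, map_smul, map_smul φ, map_smul φ', hp]
    | add s t hs ht =>
      intro p hp
      rw [add_smul, TensorProduct.tmul_add, map_add, map_add φ, map_add φ', hs p hp, ht p hp]
    | mul s t hs ht =>
      intro p hp
      rw [mul_smul]
      exact hs _ (ht _ hp)
  have hodd : ∀ p : SV F n, φ (ofOdd F m n (1 ⊗ₜ p)) = φ' (ofOdd F m n (1 ⊗ₜ p)) := by
    intro p
    induction p using SV_induction with
    | vec i => exact hv i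
    | zero => rw [TensorProduct.tmul_zero, map_zero, map_zero φ, map_zero φ']
    | add p q hp hq => rw [TensorProduct.tmul_add, map_add, map_add φ, map_add φ', hp, hq]
    | smul s p hp => exact hsmul s p hp
  -- Elements of `S_n'` are sums of terms s α_ij = (s v_i) v_j, products of odd elements already
  -- treated.
  have haug : ∀ s : SAug F n, φ (ofAug F m n (1 ⊗ₜ s)) = φ' (ofAug F m n (1 ⊗ₜ s)) := by
    intro s
    induction s using SAug_induction with
    | smul s i j =>
      rw [← oddForm_vecSV, ← oddForm_smul_left, ← mul_one (1 : PolyT F m), ← ofOdd_mul_ofOdd,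
        map_mul, map_mul, hodd, hodd]
    | zero => rw [TensorProduct.tmul_zero, map_zero, map_zero φ, map_zero φ']
    | add p q hp hq => rw [TensorProduct.tmul_add, map_add, map_add φ, map_add φ', hp, hq]
  ext x
  induction x using induction_tmul with
  | free f => exact hfree f
  | aug g s =>
    obtain ⟨f, rfl⟩ := bar_surjective F m g
    rw [← mul_one (bar F m f), ← ofFree_mul_ofAug, map_mul, map_mul, hfree, haug]
  | odd g p =>
    obtain ⟨f, rfl⟩ := bar_surjective F m g
    rw [← mul_one (bar F m f), ← ofFree_mul_ofOdd, map_mul, map_mul, hfree, hodd]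
  | add x y hx hy => rw [map_add, map_add, hx, hy]

end Model

/-! ### Homomorphisms from the model -/

open scoped IsMulCommutative in
/-- A homomorphism from the free algebra whose values on generators commute factors through the
polynomial algebra. -/
theorem exists_comp_bar {F : Type u} [Field F] {m : ℕ} {A : Type*} [Ring A] [Algebra F A]
    (r : FreeT F m →ₐ[F] A)
    (h : ∀ i j, r (FreeAlgebra.ι F i) * r (FreeAlgebra.ι F j) =
      r (FreeAlgebra.ι F j) * r (FreeAlgebra.ι F i)) :
    ∃ ρ : PolyT F m →ₐ[F] A, ∀ f, ρ (bar F m f) = r f := by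
  let T := Algebra.adjoin F (Set.range fun i => r (FreeAlgebra.ι F i))
  have : IsMulCommutative T := Algebra.isMulCommutative_adjoin F (by
    rintro _ ⟨i, rfl⟩ _ ⟨j, rfl⟩
    exact h i j)
  let ρ : PolyT F m →ₐ[F] T :=
    MvPolynomial.aeval fun i => ⟨r (FreeAlgebra.ι F i), Algebra.subset_adjoin ⟨i, rfl⟩⟩
  refine ⟨T.val.comp ρ, fun f => ?_⟩
  have : (T.val.comp ρ).comp (bar F m) = r := by
    ext i
    simp [bar, ρ]
  exact DFunLike.congr_fun this f

open scoped IsMulCommutative in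
/-- A commuting family of elements of an algebra that satisfies the relations of `2 × 2` minors
is the image of the `α_ij` under a homomorphism. -/
theorem exists_algHom_alpha_of_commute {F : Type u} [Field F] {n : ℕ} {A : Type*} [Ring A]
    [Algebra F A] (c : Fin n → Fin n → A)
    (hcomm : ∀ i j k l, c i j * c k l = c k l * c i j)
    (hself : ∀ i, c i i = 0) (hanti : ∀ i j, c i j = -c j i)
    (hc : ∀ i j k l, c i j * c k l - c i k * c j l + c i l * c j k = 0) :
    ∃ ψ : S F n →ₐ[F] A, ∀ i j, ψ (alpha F i j) = c i j := by
  let T := Algebra.adjoin F (Set.range fun p : Fin n × Fin n => c p.1 p.2)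
  have : IsMulCommutative T := Algebra.isMulCommutative_adjoin F (by
    rintro _ ⟨i, rfl⟩ _ ⟨j, rfl⟩
    exact hcomm _ _ _ _)
  obtain ⟨ψ, hψ⟩ := exists_algHom_alpha (F := F) (R := T)
    (fun i j => ⟨c i j, Algebra.subset_adjoin ⟨(i, j), rfl⟩⟩)
    (fun i => Subtype.ext (hself i)) (fun i j => Subtype.ext (hanti i j))
    (fun i j k l => Subtype.ext (hc i j k l))
  exact ⟨T.val.comp ψ, fun i j => congrArg Subtype.val (hψ i j)⟩

/-! ### Identities in an arbitrary `Γ`-algebra and the extension of generator images -/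

namespace IsGammaAlgebra

variable {F : Type u} [Field F] {H : Type w} [NonAssocRing H] [Module F H]
  [IsScalarTower F H H] [SMulCommClass F H H] {Δ : ZMod 2 → Submodule F H}

theorem even_mul_even (h : IsGammaAlgebra F Δ) {a b : H} (ha : a ∈ Δ 0) (hb : b ∈ Δ 0) :
    a * b ∈ Δ 0 := h.mul_mem 0 0 a ha b hb

theorem even_mul_odd (h : IsGammaAlgebra F Δ) {a x : H} (ha : a ∈ Δ 0) (hx : x ∈ Δ 1) :
    a * x ∈ Δ 1 := h.mul_mem 0 1 a ha x hx

theorem odd_mul_odd (h : IsGammaAlgebra F Δ) {x y : H} (hx : x ∈ Δ 1) (hy : y ∈ Δ 1) :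
    x * y ∈ Δ 0 := h.mul_mem 1 1 x hx y hy

theorem odd_mul_eq_neg (h : IsGammaAlgebra F Δ) {x y : H} (hx : x ∈ Δ 1) (hy : y ∈ Δ 1) :
    x * y = -(y * x) := eq_neg_of_add_eq_zero_left (h.odd_anticomm x hx y hy)

theorem odd_mul_even_mul (h : IsGammaAlgebra F Δ) {x a y : H} (hx : x ∈ Δ 1) (ha : a ∈ Δ 0)
    (hy : y ∈ Δ 1) : x * (a * y) = a * (x * y) := by
  rw [h.odd_mul_eq_neg hx (h.even_mul_odd ha hy), h.assoc a ha, h.odd_mul_eq_neg hx hy, mul_neg]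

/-- Moving `a` across an odd element twice gives a(bx) = (bx)a = b(xa) = b(ax). This is why
noncommutativity of the even generators is invisible outside F⟨t⟩. -/
theorem mul_mul_odd_comm (h : IsGammaAlgebra F Δ) {a b x : H} (ha : a ∈ Δ 0) (hb : b ∈ Δ 0)
    (hx : x ∈ Δ 1) : (a * b) * x = (b * a) * x := by
  rw [h.assoc a ha, h.even_odd_comm a ha _ (h.even_mul_odd hb hx), h.assoc b hb,
    ← h.even_odd_comm a ha x hx, h.assoc b hb]

theorem mul_mul_odd_mul_odd_comm (h : IsGammaAlgebra F Δ) {a b x y : H} (ha : a ∈ Δ 0)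
    (hb : b ∈ Δ 0) (hx : x ∈ Δ 1) : (a * b) * (x * y) = (b * a) * (x * y) := by
  rw [← h.assoc _ (h.even_mul_even ha hb), ← h.assoc _ (h.even_mul_even hb ha),
    h.mul_mul_odd_comm ha hb hx]

variable (Δ) in
/-- The span `Γ₁²` of the products of odd elements. -/
def oddSq : Submodule F H := Submodule.span F {z | ∃ x ∈ Δ 1, ∃ y ∈ Δ 1, x * y = z}

theorem oddSq_le (h : IsGammaAlgebra F Δ) : oddSq Δ ≤ Δ 0 := by
  rw [oddSq, Submodule.span_le]
  rintro _ ⟨x, hx, y, hy, rfl⟩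
  exact h.odd_mul_odd hx hy

theorem even_mul_oddSq (h : IsGammaAlgebra F Δ) {a z : H} (ha : a ∈ Δ 0) (hz : z ∈ oddSq Δ) :
    a * z ∈ oddSq Δ := by
  induction hz using Submodule.span_induction with
  | mem z hz =>
    obtain ⟨x, hx, y, hy, rfl⟩ := hz
    rw [← h.assoc a ha]
    exact Submodule.subset_span ⟨_, h.even_mul_odd ha hx, y, hy, rfl⟩
  | zero => rw [mul_zero]; exact zero_mem _
  | add x y _ _ hx hy => rw [mul_add]; exact add_mem hx hy
  | smul c x _ hx => rw [mul_smul_comm]; exact Submodule.smul_mem _ c hx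

theorem oddSq_mul_even (h : IsGammaAlgebra F Δ) {a z : H} (ha : a ∈ Δ 0) (hz : z ∈ oddSq Δ) :
    z * a = a * z := by
  induction hz using Submodule.span_induction with
  | mem z hz =>
    obtain ⟨x, hx, y, hy, rfl⟩ := hz
    exact h.odd_mul_odd_central x hx y hy a ha
  | zero => rw [mul_zero, zero_mul]
  | add x y _ _ hx hy => rw [mul_add, add_mul, hx, hy]
  | smul c x _ hx => rw [mul_smul_comm, smul_mul_assoc, hx]

theorem mul_mul_mul_of_mem_oddSq (h : IsGammaAlgebra F Δ) {a c z : H} (ha : a ∈ Δ 0) (hc : c ∈ Δ 0)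
    (hz : z ∈ oddSq Δ) (y : H) : (a * z) * (c * y) = (a * c) * (z * y) := by
  rw [h.assoc a ha, h.assoc a ha, ← h.assoc z (h.oddSq_le hz), h.oddSq_mul_even hc hz, h.assoc c hc]

variable (Δ) in
/-- The elements on which commutators of even elements act trivially. -/
def commKer : Submodule F H where
  carrier := {z | ∀ a ∈ Δ 0, ∀ b ∈ Δ 0, (a * b) * z = (b * a) * z}
  zero_mem' a _ b _ := by rw [mul_zero, mul_zero]
  add_mem' {x y} hx hy a ha b hb := by rw [mul_add, mul_add, hx a ha b hb, hy a ha b hb]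
  smul_mem' c x hx a ha b hb := by rw [mul_smul_comm, mul_smul_comm, hx a ha b hb]

theorem odd_le_commKer (h : IsGammaAlgebra F Δ) : Δ 1 ≤ commKer Δ :=
  fun _ hx _ ha _ hb => h.mul_mul_odd_comm ha hb hx

theorem oddSq_le_commKer (h : IsGammaAlgebra F Δ) : oddSq Δ ≤ commKer Δ := by
  rw [oddSq, Submodule.span_le]
  rintro _ ⟨x, hx, y, hy, rfl⟩ a ha b hb
  exact h.mul_mul_odd_mul_odd_comm ha hb hx

theorem mul_left_comm_of_mem_commKer (h : IsGammaAlgebra F Δ) {a b z : H} (ha : a ∈ Δ 0)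
    (hb : b ∈ Δ 0) (hz : z ∈ commKer Δ) : a * (b * z) = b * (a * z) := by
  rw [← h.assoc a ha, ← h.assoc b hb]
  exact hz a ha b hb

/-- Needed so that even elements act on `commKer`: b(c(az)) = (ca)(bz) = c(a(bz)) = c(b(az)). -/
theorem mul_mem_commKer (h : IsGammaAlgebra F Δ) {a z : H} (ha : a ∈ Δ 0)
    (hz : z ∈ commKer Δ) : a * z ∈ commKer Δ := by
  intro b hb c hc
  rw [h.assoc b hb, h.assoc c hc, ← h.assoc c hc a,
    h.mul_left_comm_of_mem_commKer hb (h.even_mul_even hc ha) hz, h.assoc c hc,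
    h.mul_left_comm_of_mem_commKer ha hb hz]

/-- Evaluation of the free associative algebra at even elements. -/
theorem exists_eval (h : IsGammaAlgebra F Δ) {m : ℕ} (a : Fin m → H) (ha : ∀ i, a i ∈ Δ 0) :
    ∃ E : FreeT F m →ₗ[F] H, E 1 = 1 ∧ (∀ f g, E (f * g) = E f * E g) ∧ (∀ f, E f ∈ Δ 0) ∧
      ∀ i, E (FreeAlgebra.ι F i) = a i := by
  -- `H` need not be associative, so the free algebra is sent to operators and evaluated at 1. Each
  -- operator is left multiplication by its value at 1, because that value is even.
  let e : FreeT F m →ₐ[F] Module.End F H := FreeAlgebra.lift F fun i => LinearMap.mulLeft F (a i)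
  have he : ∀ f, e f 1 ∈ Δ 0 ∧ ∀ z, e f z = e f 1 * z := by
    intro f
    induction f using FreeAlgebra.induction with
    | grade0 r =>
      simp only [AlgHom.commutes, Module.algebraMap_end_apply]
      exact ⟨Submodule.smul_mem _ _ h.one_mem, fun z => by rw [smul_mul_assoc, one_mul]⟩
    | grade1 i => simp [e, ha i]
    | mul f g hf hg =>
      simp only [map_mul, Module.End.mul_apply]
      rw [hf.2 (e g 1)]
      exact ⟨h.even_mul_even hf.1 hg.1, fun z => by rw [hg.2 z, hf.2, h.assoc _ hf.1]⟩
    | add f g hf hg =>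
      simp only [map_add, LinearMap.add_apply]
      exact ⟨add_mem hf.1 hg.1, fun z => by rw [add_mul, hf.2 z, hg.2 z]⟩
  refine ⟨(LinearMap.applyₗ (1 : H)).comp e.toLinearMap, ?_, fun f g => ?_, fun f => (he f).1,
    fun i => ?_⟩
  · simp
  · simpa using (he f).2 (e g 1)
  · simp [e]

/-- The left action of the free algebra on `commKer` factors through the polynomial algebra. -/
theorem exists_tensor_lift (h : IsGammaAlgebra F Δ) {m : ℕ} {E : FreeT F m →ₗ[F] H} (h1 : E 1 = 1)
    (hmul : ∀ f g, E (f * g) = E f * E g) (heven : ∀ f, E f ∈ Δ 0)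
    {U : Type*} [AddCommGroup U] [Module F U] (w : U →ₗ[F] H) (hw : ∀ x, w x ∈ commKer Δ) :
    ∃ A : PolyT F m ⊗[F] U →ₗ[F] H, ∀ f x, A (bar F m f ⊗ₜ x) = E f * w x := by
  let op (f : FreeT F m) : Module.End F (commKer Δ) :=
    (LinearMap.mulLeft F (E f)).restrict fun z hz => h.mul_mem_commKer (heven f) hz
  have hop : ∀ f z, (op f z : H) = E f * z := fun f z => rfl
  let r : FreeT F m →ₐ[F] Module.End F (commKer Δ) := AlgHom.ofLinearMap
    { toFun := op
      map_add' := fun f g => LinearMap.ext fun z => Subtype.ext <| by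
        rw [LinearMap.add_apply, Submodule.coe_add, hop, hop, hop, map_add, add_mul]
      map_smul' := fun c f => LinearMap.ext fun z => Subtype.ext <| by
        rw [RingHom.id_apply, LinearMap.smul_apply, Submodule.coe_smul, hop, hop, map_smul,
          smul_mul_assoc] }
    (LinearMap.ext fun z => Subtype.ext <| (hop 1 z).trans <| by
      rw [h1, one_mul, Module.End.one_apply])
    (fun f g => LinearMap.ext fun z => Subtype.ext <| (hop _ z).trans <| by
      rw [hmul, h.assoc _ (heven f)]; rfl)
  have hr : ∀ f z, (r f z : H) = E f * z := hop
  obtain ⟨ρ, hρ⟩ := exists_comp_bar r fun i j => by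
    ext z
    simp only [Module.End.mul_apply, hr]
    exact h.mul_left_comm_of_mem_commKer (heven _) (heven _) z.2
  refine ⟨TensorProduct.lift (LinearMap.mk₂ F (fun g x => ((ρ g ⟨w x, hw x⟩ : commKer Δ) : H))
    (fun g g' x => by simp) (fun c g x => by simp) (fun g x y => ?_) (fun c g x => ?_)),
    fun f x => ?_⟩
  · have : (⟨w (x + y), hw (x + y)⟩ : commKer Δ) = ⟨w x, hw x⟩ + ⟨w y, hw y⟩ :=
      Subtype.ext (map_add w x y)
    rw [this, map_add]; rfl
  · have : (⟨w (c • x), hw (c • x)⟩ : commKer Δ) = c • ⟨w x, hw x⟩ :=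
      Subtype.ext (map_smul w c x)
    rw [this, map_smul]; rfl
  · rw [TensorProduct.lift.tmul, LinearMap.mk₂_apply, hρ, hr]

/-- Multiply the cyclic identity for x, y, z by t on the right and reassociate; products of odd
elements are even and central in Γ₀. -/
theorem odd_plucker (h : IsGammaAlgebra F Δ) {x y z t : H} (hx : x ∈ Δ 1) (hy : y ∈ Δ 1)
    (hz : z ∈ Δ 1) (ht : t ∈ Δ 1) :
    (x * y) * (z * t) - (x * z) * (y * t) + (x * t) * (y * z) = 0 := by
  have e := congrArg (· * t) (h.odd_cyclic x hx y hy z hz)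
  simp only [add_mul, zero_mul] at e
  rw [h.assoc _ (h.odd_mul_odd hx hy), h.assoc _ (h.odd_mul_odd hy hz),
    h.assoc _ (h.odd_mul_odd hz hx), h.odd_mul_eq_neg hz hx,
    h.odd_mul_odd_central y hy z hz _ (h.odd_mul_odd hx ht), neg_mul] at e
  rw [← e]; abel

/-- The homomorphism from `S_n` that sends `α_ij` to `b_i b_j`. -/
theorem exists_hom_S (h : IsGammaAlgebra F Δ) {n : ℕ} (b : Fin n → H) (hb : ∀ j, b j ∈ Δ 1) :
    ∃ ψ : S F n →ₐ[F] Module.End F H, (∀ i j, ψ (alpha F i j) 1 = b i * b j) ∧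
      ∀ s, ψ s 1 ∈ Δ 0 ∧ ∀ z, ψ s z = ψ s 1 * z := by
  have hbb := fun i j => h.odd_mul_odd (hb i) (hb j)
  obtain ⟨ψ, hψ⟩ := exists_algHom_alpha_of_commute (F := F)
    (fun i j => LinearMap.mulLeft F (b i * b j))
    (fun i j k l => by
      ext z
      simp only [Module.End.mul_apply, LinearMap.mulLeft_apply]
      rw [← h.assoc _ (hbb i j), ← h.assoc _ (hbb k l),
        h.odd_mul_odd_central _ (hb i) _ (hb j) _ (hbb k l)])
    (fun i => by ext z; simp [h.odd_mul_self _ (hb i)])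
    (fun i j => by ext z; simp [h.odd_mul_eq_neg (hb i) (hb j)])
    (fun i j k l => by
      ext z
      simp only [LinearMap.add_apply, LinearMap.sub_apply, Module.End.mul_apply,
        LinearMap.mulLeft_apply, LinearMap.zero_apply]
      rw [← h.assoc _ (hbb i j), ← h.assoc _ (hbb i k), ← h.assoc _ (hbb i l), ← sub_mul,
        ← add_mul, h.odd_plucker (hb i) (hb j) (hb k) (hb l), zero_mul])
  refine ⟨ψ, fun i j => by simp [hψ], fun s => ?_⟩
  induction s using S_induction with
  | alpha i j => simp [hψ, hbb i j]
  | algebraMap c =>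
    simp only [AlgHom.commutes, Module.algebraMap_end_apply]
    exact ⟨Submodule.smul_mem _ _ h.one_mem, fun z => by rw [smul_mul_assoc, one_mul]⟩
  | add s t hs ht =>
    simp only [map_add, LinearMap.add_apply]
    exact ⟨add_mem hs.1 ht.1, fun z => by rw [add_mul, hs.2 z, ht.2 z]⟩
  | mul s t hs ht =>
    simp only [map_mul, Module.End.mul_apply]
    rw [hs.2 (ψ t 1)]
    exact ⟨h.even_mul_even hs.1 ht.1, fun z => by rw [ht.2 z, hs.2, h.assoc _ hs.1]⟩

theorem exists_hom_S_SV (h : IsGammaAlgebra F Δ) {n : ℕ} (b : Fin n → H) (hb : ∀ j, b j ∈ Δ 1) :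
    ∃ (ψ : S F n →ₗ[F] H) (χ : SV F n →ₗ[F] H),
      (∀ s t, ψ (s * t) = ψ s * ψ t) ∧ (∀ i j, ψ (alpha F i j) = b i * b j) ∧
      (∀ s, ψ s ∈ Δ 0) ∧ (∀ j, χ (vecSV F j) = b j) ∧ (∀ p, χ p ∈ Δ 1) ∧
      ∀ (s : S F n) (p : SV F n), χ (s • p) = ψ s * χ p := by
  obtain ⟨ψ, hψ, hψ'⟩ := h.exists_hom_S b hb
  -- `H` becomes an `S_n`-module in which α_ij acts as b_i b_j; the cyclic relations for the b_j are
  -- then `odd_cyclic`, and the presentation of `S_n V` applies.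
  let _ : Module (S F n) H := Module.compHom H ψ.toRingHom
  have hsmul : ∀ (s : S F n) (z : H), s • z = ψ s z := fun _ _ => rfl
  have : IsScalarTower F (S F n) H := ⟨fun c s z => by simp [hsmul]⟩
  obtain ⟨χ, hχ⟩ := exists_linearMap_vecSV (F := F) b fun i j k => by
    rw [hsmul, hsmul, hsmul, (hψ' _).2, (hψ' _).2 (b i), (hψ' _).2 (b j), hψ, hψ, hψ]
    exact h.odd_cyclic _ (hb i) _ (hb j) _ (hb k)
  have hχs : ∀ (s : S F n) (p : SV F n), χ (s • p) = ψ s 1 * χ p := fun s p => by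
    rw [map_smul, hsmul, (hψ' s).2]
  refine ⟨(LinearMap.applyₗ (1 : H)).comp ψ.toLinearMap, χ.restrictScalars F, fun s t => ?_,
    hψ, fun s => (hψ' s).1, hχ, fun p => ?_, hχs⟩
  · simpa using (hψ' s).2 (ψ t 1)
  · change χ p ∈ Δ 1
    induction p using SV_induction with
    | vec i => rw [hχ]; exact hb i
    | zero => rw [map_zero]; exact zero_mem _
    | add p q hp hq => rw [map_add]; exact add_mem hp hq
    | smul s p hp => rw [hχs]; exact h.even_mul_odd (hψ' s).1 hp

/-- Even images of the `t_i` and odd images of the `v_j` in a `Γ`-algebra extend to a homomorphism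
from the model. -/
theorem exists_hom_model (h : IsGammaAlgebra F Δ) {m n : ℕ} (a : Fin m → H) (b : Fin n → H)
    (ha : ∀ i, a i ∈ Δ 0) (hb : ∀ j, b j ∈ Δ 1) :
    ∃ φ : Model F m n →ₙₐ[F] H, φ 1 = 1 ∧
      (∀ k, ∀ x ∈ Model.grading F m n k, φ x ∈ Δ k) ∧
      (∀ i, φ (Model.genT F n i) = a i) ∧ (∀ j, φ (Model.genV F m j) = b j) := by
  obtain ⟨E, hE1, hEmul, hE0, hEa⟩ := h.exists_eval a ha
  obtain ⟨ψ, χ, hψmul, hψb, hψ0, hχb, hχ1, hχs⟩ := h.exists_hom_S_SV b hb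
  let ω : SAug F n →ₗ[F] H := ψ.comp ((SAug F n).subtype.restrictScalars F)
  have hωsmul : ∀ (s : S F n) (t : SAug F n), ω (s • t) = ψ s * ω t := fun s t => hψmul s t
  -- On `S_n'`, unlike on all of `S_n`, the values lie in Γ₁². There commutators act trivially, so
  -- the tensor lift exists, and even elements commute with the values.
  have hωsq : ∀ s, ω s ∈ oddSq Δ := by
    intro s
    induction s using SAug_induction with
    | smul s i j =>
      rw [hωsmul]
      refine h.even_mul_oddSq (hψ0 s) (Submodule.subset_span ⟨b i, hb i, b j, hb j, ?_⟩)
      exact (hψb i j).symm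
    | zero => rw [map_zero]; exact zero_mem _
    | add s t hs ht => rw [map_add]; exact add_mem hs ht
  have hω0 : ∀ s, ω s ∈ Δ 0 := fun s => h.oddSq_le (hωsq s)
  have hωmul : ∀ s t : SAug F n, ω (augMul F n s t) = ω s * ω t := fun s t => hωsmul s t
  have hχact : ∀ (s : SAug F n) (p : SV F n), χ (augAct F n s p) = ω s * χ p := fun s p => hχs s p
  -- Both sides are `S_n`-bilinear, with `S_n` acting through ψ, so the v_i suffice.
  have hωform : ∀ p q : SV F n, ω (oddForm F n p q) = χ p * χ q := by
    intro p q
    induction p using SV_induction with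
    | vec i =>
      induction q using SV_induction with
      | vec j => rw [oddForm_vecSV, hχb, hχb]; exact hψb i j
      | zero => rw [map_zero, map_zero, map_zero, mul_zero]
      | add p q hp hq => rw [map_add, map_add, map_add, mul_add, hp, hq]
      | smul s p hp =>
        rw [oddForm_smul_right, hωsmul, hp, hχs, h.odd_mul_even_mul (hχ1 _) (hψ0 s) (hχ1 _)]
    | zero => rw [map_zero, map_zero, LinearMap.zero_apply, map_zero, zero_mul]
    | add p q hp hq => rw [map_add, map_add, LinearMap.add_apply, map_add, add_mul, hp, hq]
    | smul s p hp => rw [oddForm_smul_left, hωsmul, hp, hχs, h.assoc _ (hψ0 s)]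
  obtain ⟨A, hA⟩ := h.exists_tensor_lift hE1 hEmul hE0 ω fun s => h.oddSq_le_commKer (hωsq s)
  obtain ⟨X, hX⟩ := h.exists_tensor_lift hE1 hEmul hE0 χ fun p => h.odd_le_commKer (hχ1 p)
  let φ : Model F m n →ₗ[F] H :=
    { toFun := fun x => E x.free + A x.aug + X x.odd
      map_add' := fun x y => by
        simp only [Model.add_free, Model.add_aug, Model.add_odd, map_add]; abel
      map_smul' := fun c x => by
        simp only [Model.smul_free, Model.smul_aug, Model.smul_odd, map_smul, smul_add,
          RingHom.id_apply] }
  have hfree : ∀ f, φ (Model.ofFree F m n f) = E f := fun f => by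
    change E f + A 0 + X 0 = E f
    simp
  have haug : ∀ f s, φ (Model.ofAug F m n (bar F m f ⊗ₜ s)) = E f * ω s := fun f s => by
    change E 0 + A (bar F m f ⊗ₜ s) + X 0 = _
    simp [hA]
  have hodd : ∀ f p, φ (Model.ofOdd F m n (bar F m f ⊗ₜ p)) = E f * χ p := fun f p => by
    change E 0 + A 0 + X (bar F m f ⊗ₜ p) = _
    simp [hX]
  -- Since `bar` is surjective, each polynomial factor may be taken to be some f̄, where the lifts
  -- have the explicit values E f · ω s and E f · χ p.
  have hmul : ∀ x y, φ (x * y) = φ x * φ y := by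
    intro x y
    refine Model.induction_tmul (fun f => ?_) (fun g s => ?_) (fun g p => ?_)
      (fun x x' hx hx' => by rw [add_mul, map_add, hx, hx', map_add, add_mul]) x <;>
    refine Model.induction_tmul (fun f' => ?_) (fun g' s' => ?_) (fun g' p' => ?_)
      (fun y y' hy hy' => by rw [mul_add, map_add, hy, hy', map_add, mul_add]) y
    · rw [Model.ofFree_mul_ofFree, hfree, hfree, hfree, hEmul]
    · obtain ⟨f', rfl⟩ := bar_surjective F m g'
      rw [Model.ofFree_mul_ofAug, ← map_mul, haug, hfree, haug, hEmul, h.assoc _ (hE0 f)]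
    · obtain ⟨f', rfl⟩ := bar_surjective F m g'
      rw [Model.ofFree_mul_ofOdd, ← map_mul, hodd, hfree, hodd, hEmul, h.assoc _ (hE0 f)]
    · obtain ⟨f, rfl⟩ := bar_surjective F m g
      rw [Model.ofAug_mul_ofFree, ← map_mul, haug, hfree, haug, hEmul, h.assoc _ (hE0 f'),
        h.oddSq_mul_even (hE0 f') (h.even_mul_oddSq (hE0 f) (hωsq s))]
    · obtain ⟨f, rfl⟩ := bar_surjective F m g
      obtain ⟨f', rfl⟩ := bar_surjective F m g'
      rw [Model.ofAug_mul_ofAug, ← map_mul, haug, haug, haug, hEmul, hωmul,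
        h.mul_mul_mul_of_mem_oddSq (hE0 f) (hE0 f') (hωsq s)]
    · obtain ⟨f, rfl⟩ := bar_surjective F m g
      obtain ⟨f', rfl⟩ := bar_surjective F m g'
      rw [Model.ofAug_mul_ofOdd, ← map_mul, hodd, haug, hodd, hEmul, hχact,
        h.mul_mul_mul_of_mem_oddSq (hE0 f) (hE0 f') (hωsq s)]
    · obtain ⟨f, rfl⟩ := bar_surjective F m g
      rw [Model.ofOdd_mul_ofFree, ← map_mul, hodd, hfree, hodd, hEmul, h.assoc _ (hE0 f'),
        ← h.even_odd_comm _ (hE0 f') _ (h.even_mul_odd (hE0 f) (hχ1 p))]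
    · obtain ⟨f, rfl⟩ := bar_surjective F m g
      obtain ⟨f', rfl⟩ := bar_surjective F m g'
      rw [Model.ofOdd_mul_ofAug, ← map_mul, hodd, hodd, haug, hEmul, hχact,
        ← h.even_odd_comm _ (h.even_mul_even (hE0 f') (hω0 s')) _ (h.even_mul_odd (hE0 f) (hχ1 p)),
        h.mul_mul_mul_of_mem_oddSq (hE0 f') (hE0 f) (hωsq s')]
    · obtain ⟨f, rfl⟩ := bar_surjective F m g
      obtain ⟨f', rfl⟩ := bar_surjective F m g'
      rw [Model.ofOdd_mul_ofOdd, ← map_mul, haug, hodd, hodd, hEmul, hωform, h.assoc _ (hE0 f),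
        h.assoc _ (hE0 f), h.odd_mul_even_mul (hχ1 p) (hE0 f') (hχ1 p')]
  refine ⟨{ φ with map_mul' := hmul, map_zero' := map_zero φ }, ?_, ?_, fun i => ?_, fun j => ?_⟩
  · exact (hfree 1).trans hE1
  · intro k x hx
    change φ x ∈ Δ k
    have hk : ∀ k : ZMod 2, k = 0 ∨ k = 1 := by decide
    obtain rfl | rfl := hk k
    · refine Model.even_induction (fun f => ?_) (fun g s => ?_)
        (fun x y hx hy => by rw [map_add]; exact add_mem hx hy) x hx
      · rw [hfree]; exact hE0 f
      · obtain ⟨f, rfl⟩ := bar_surjective F m g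
        rw [haug]; exact h.even_mul_even (hE0 f) (hω0 s)
    · refine Model.odd_induction (fun g p => ?_)
        (fun x y hx hy => by rw [map_add]; exact add_mem hx hy) x hx
      obtain ⟨f, rfl⟩ := bar_surjective F m g
      rw [hodd]; exact h.even_mul_odd (hE0 f) (hχ1 p)
  · exact (hfree _).trans (hEa i)
  · change φ (Model.ofOdd F m n (1 ⊗ₜ vecSV F j)) = b j
    rw [← map_one (bar F m), hodd, hE1, hχb, one_mul]

end IsGammaAlgebra

theorem Model.isFreeGammaAlgebra (F : Type u) [Field F] (m n : ℕ) :
    IsFreeGammaAlgebra.{u, w} F (Model.grading F m n) (Model.genT F n) (Model.genV F m) where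
  isGammaAlgebra := Model.isGammaAlgebra F m n
  even_gen _ := Model.ofFree_mem _
  odd_gen _ := Model.ofOdd_mem _
  existsUnique_hom H _ _ _ _ Δ h a b ha hb := by
    obtain ⟨φ, h1, hgr, ht, hv⟩ := h.exists_hom_model a b ha hb
    refine ⟨φ, ⟨h1, hgr, ht, hv⟩, fun φ' ⟨h1', _, ht', hv'⟩ => ?_⟩
    exact Model.hom_ext (h1'.trans h1.symm) (fun i => (ht' i).trans (ht i).symm)
      (fun j => (hv' j).trans (hv j).symm)

end GammaAlg

open GammaAlg GammaAlg.Model in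
theorem theorem8 (F : Type u) [Field F] (m n : ℕ) :
    -- `Γ₀ = F⟨t⟩ ⊕ F[t̄] ⊗ S_n'`, `Γ₁ = F[t̄] ⊗ S_n V` is the free `Γ`-algebra on `t_i`, `v_j`
    IsFreeGammaAlgebra.{u, w} F (grading F m n) (genT F n) (genV F m) ∧
    -- `S_n V = ⊕_j B_{n,j} V_j`, and the `b v_j` with `b ∈ B_{n,j}` form a basis of `B_{n,j} V_j`
    DirectSum.IsInternal (fun j : Fin n => BV F j) ∧
    (∀ j : Fin n, LinearIndependent F (fun b : B F j => (b : S F n) • vecSV F j)) ∧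
    -- `v_i v_j = α_ij`
    (∀ i j : Fin n, genV F m i * genV F m j = ofAug F m n (1 ⊗ₜ alphaAug F i j)) ∧
    -- `F⟨t⟩` is a subalgebra and acts on the other summands, from both sides, through `f ↦ f̄`
    (∀ f g : FreeT F m, ofFree F m n f * ofFree F m n g = ofFree F m n (f * g)) ∧
    (∀ (f : FreeT F m) (g : PolyT F m) (s : SAug F n),
      ofFree F m n f * ofAug F m n (g ⊗ₜ s) = ofAug F m n ((bar F m f * g) ⊗ₜ s) ∧
      ofAug F m n (g ⊗ₜ s) * ofFree F m n f = ofAug F m n ((bar F m f * g) ⊗ₜ s)) ∧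
    (∀ (f : FreeT F m) (g : PolyT F m) (p : SV F n),
      ofFree F m n f * ofOdd F m n (g ⊗ₜ p) = ofOdd F m n ((bar F m f * g) ⊗ₜ p) ∧
      ofOdd F m n (g ⊗ₜ p) * ofFree F m n f = ofOdd F m n ((bar F m f * g) ⊗ₜ p)) ∧
    -- the other summands multiply as in `F[t̄] ⊗ (S_n ⊕ S_n V)`
    (∀ (g h : PolyT F m) (s s' : SAug F n),
      ofAug F m n (g ⊗ₜ s) * ofAug F m n (h ⊗ₜ s') = ofAug F m n ((g * h) ⊗ₜ augMul F n s s')) ∧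
    (∀ (g h : PolyT F m) (s : SAug F n) (p : SV F n),
      ofAug F m n (g ⊗ₜ s) * ofOdd F m n (h ⊗ₜ p) = ofOdd F m n ((g * h) ⊗ₜ augAct F n s p) ∧
      ofOdd F m n (h ⊗ₜ p) * ofAug F m n (g ⊗ₜ s) = ofOdd F m n ((g * h) ⊗ₜ augAct F n s p)) ∧
    (∀ (g h : PolyT F m) (p q : SV F n),
      ofOdd F m n (g ⊗ₜ p) * ofOdd F m n (h ⊗ₜ q)
        = ofAug F m n ((g * h) ⊗ₜ oddForm F n p q)) := by
  refine ⟨Model.isFreeGammaAlgebra F m n, isInternal_BV F n, linearIndependent_B F,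
    genV_mul_genV, ofFree_mul_ofFree, fun f g s => ⟨ofFree_mul_ofAug f g s, ofAug_mul_ofFree f g s⟩,
    fun f g p => ⟨ofFree_mul_ofOdd f g p, ofOdd_mul_ofFree f g p⟩, ofAug_mul_ofAug,
    fun g h s p => ⟨ofAug_mul_ofOdd g h s p, ofOdd_mul_ofAug g h s p⟩, ofOdd_mul_ofOdd⟩
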